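/- Let $d\ge 2$ and $k\ge 1$ be integers, and let $f:\mathbb{R}^d\to[0,\infty)$ be a bounded Lebesgue-measurable function with $\int_{\mathbb{R}^d} f(x)\,dx=1$. Then there is a constant $C_k>0$, depending only on $k$ and $f$, such that the following holds. Let $x_1,x_2,\dots$ be independent identically distributed random points of $\mathbb{R}^d$ with density $f$, let $\epsilon>0$, and let $(r_n)$ be a sequence of positive real numbers with $r_n=O(n^{-1/d-\epsilon})$. Let $R_n=R(\{x_1,\dots,x_n\};r_n)$ be the Vietoris–Rips complex, that is, the simplicial complex with vertices $x_1,\dots,x_n$ in which a nonempty set of vertices is a face if and only if the closed balls of radius $r_n/2$ about its points meet pairwise. Let $\beta_k$ be the $k$th Betti number $\dim H_k(R_n;\mathbb{F})$, where $\mathbb{F}$ is any field, and let $\widetilde o_k$ be the number of connected components of $R_n$ that are isomorphic, as simplicial complexes, to the boundary of the $(k+1)$-dimensional cross-polytope. Then, as $n\to\infty$, $$\frac{E[\beta_k]}{n^{2k+2}\,r_n^{d(2k+1)}}\longrightarrow C_k \qquad\text{and}\qquad \frac{E[\beta_k]}{E[\widetilde o_k]}\longrightarrow 1.$$ -/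

import Mathlib

open MeasureTheory ProbabilityTheory Filter Topology Asymptotics

noncomputable section

namespace RandomRips

/-! ### Simplicial homology with field coefficients -/

section Homology

/-- The quotient `Z / (B ∩ Z)` of a subspace `Z`; this is `Z / B` when `B ≤ Z`. -/
abbrev Subquotient (F : Type*) [Field F] {M : Type*} [AddCommGroup M] [Module F M]
    (Z B : Submodule F M) : Type _ :=
  Z ⧸ B.submoduleOf Z

variable (F : Type*) [Field F] {V : Type*} [LinearOrder V]

/-- The sign `(-1)^i`, where `v` is the `i`-th vertex (counted from `0`) of the simplex `s`
in increasing order. -/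
def vertexSign (s : Finset V) (v : V) : F :=
  (-1) ^ (s.filter (fun w => w < v)).card

/-- The (augmented) simplicial boundary operator
`∂ [v₀ < ⋯ < v_k] = ∑ i, (-1)^i [v₀, …, v̂_i, …, v_k]`
on the free `F`-module on all finite subsets of `V`. -/
def boundary : (Finset V →₀ F) →ₗ[F] (Finset V →₀ F) :=
  Finsupp.linearCombination F
    (fun s : Finset V => ∑ v ∈ s, Finsupp.single (s.erase v) (vertexSign F s v))

theorem boundary_single (s : Finset V) :
    boundary F (Finsupp.single s 1) =
      ∑ v ∈ s, Finsupp.single (s.erase v) (vertexSign F s v) := by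
  simp [boundary]

theorem vertexSign_swap (s : Finset V) {v w : V} (hv : v ∈ s) (hvw : v < w) :
    vertexSign F s v * vertexSign F (s.erase v) w
      + vertexSign F s w * vertexSign F (s.erase w) v = 0 := by
  have h1 : (s.filter (fun x => x < w)).card
      = ((s.erase v).filter (fun x => x < w)).card + 1 := by
    rw [Finset.filter_erase, Finset.card_erase_add_one]
    simp [hv, hvw]
  have h2 : (s.erase w).filter (fun x => x < v) = s.filter (fun x => x < v) := by
    rw [Finset.filter_erase, Finset.erase_eq_of_notMem]
    simp [hvw.le]
  simp only [vertexSign, h1, h2]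
  ring

/-- `∂ ∘ ∂ = 0`. -/
theorem boundary_boundary (c : Finset V →₀ F) : boundary F (boundary F c) = 0 := by
  have key : ∀ s : Finset V, boundary F (boundary F (Finsupp.single s 1)) = 0 := by
    intro s
    have h : boundary F (boundary F (Finsupp.single s (1 : F)))
        = ∑ v ∈ s, ∑ w ∈ s.erase v,
          Finsupp.single ((s.erase v).erase w)
            (vertexSign F s v * vertexSign F (s.erase v) w) := by
      rw [boundary_single, map_sum]
      refine Finset.sum_congr rfl fun v _ => ?_
      rw [← mul_one (vertexSign F s v), ← smul_eq_mul, ← Finsupp.smul_single, map_smul,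
        boundary_single, Finset.smul_sum]
      refine Finset.sum_congr rfl fun w _ => ?_
      simp
    rw [h, Finset.sum_sigma']
    refine Finset.sum_involution (fun p _ => ⟨p.2, p.1⟩) ?_ ?_ ?_ ?_
    · rintro ⟨v, w⟩ hp
      simp only [Finset.mem_sigma, Finset.mem_erase] at hp
      obtain ⟨hv, hne, hw⟩ := hp
      simp only
      rw [Finset.erase_right_comm (a := w) (b := v), ← Finsupp.single_add]
      rcases lt_or_gt_of_ne hne with hlt | hlt
      · rw [add_comm, vertexSign_swap F s hw hlt, Finsupp.single_zero]
      · rw [vertexSign_swap F s hv hlt, Finsupp.single_zero]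
    · rintro ⟨v, w⟩ hp _ heq
      simp only [Finset.mem_sigma, Finset.mem_erase] at hp
      simp only [Sigma.mk.injEq] at heq
      exact hp.2.1 heq.1
    · rintro ⟨v, w⟩ hp
      simp only [Finset.mem_sigma, Finset.mem_erase] at hp ⊢
      exact ⟨hp.2.2, hp.2.1.symm, hp.1⟩
    · rintro ⟨v, w⟩ _
      rfl
  induction c using Finsupp.induction_linear with
  | zero => simp
  | add a b ha hb => simp [ha, hb]
  | single s a =>
    rw [← mul_one a, ← smul_eq_mul, ← Finsupp.smul_single, map_smul, map_smul, key, smul_zero]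

variable (K : AbstractSimplicialComplex V) (k : ℕ)

/-- The simplicial `k`-chains `C_k(K; F)`: combinations of faces with `k + 1` vertices. -/
def chains : Submodule F (Finset V →₀ F) :=
  Finsupp.supported F F {s | s ∈ K.faces ∧ s.card = k + 1}

/-- The `k`-cycles. Homology is unreduced, so every `0`-chain is a cycle. -/
def cycles : Submodule F (Finset V →₀ F) :=
  if k = 0 then chains F K 0 else chains F K k ⊓ LinearMap.ker (boundary F)

/-- The `k`-boundaries. -/
def boundaries : Submodule F (Finset V →₀ F) :=
  (chains F K (k + 1)).map (boundary F)

theorem boundaries_le_cycles : boundaries F K k ≤ cycles F K k := by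
  have h : boundaries F K k ≤ chains F K k := by
    rw [boundaries, Submodule.map_le_iff_le_comap, chains, Finsupp.supported_eq_span_single,
      Submodule.span_le]
    rintro _ ⟨s, ⟨hs, hcard⟩, rfl⟩
    simp only [Submodule.comap_coe, Set.mem_preimage, SetLike.mem_coe, boundary_single]
    refine Submodule.sum_mem _ fun v hv => Finsupp.single_mem_supported F _ ?_
    have hc : (s.erase v).card = k + 1 := by
      rw [Finset.card_erase_of_mem hv, hcard]; rfl
    refine ⟨(K.isRelLowerSet_faces hs).2 (Finset.erase_subset v s) ?_, hc⟩
    rw [← Finset.card_pos, hc]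
    exact Nat.succ_pos k
  unfold cycles
  split_ifs with hk
  · subst hk; exact h
  · refine le_inf h ?_
    rintro _ ⟨c, _, rfl⟩
    exact boundary_boundary F c

/-- The simplicial homology `H_k(K; F) = Z_k / B_k`. -/
abbrev Homology : Type _ :=
  Subquotient F (cycles F K k) (boundaries F K k)

/-- The `k`-th Betti number `β_k = dim H_k(K; F)`. -/
def betti : ℕ := Module.finrank F (Homology F K k)

end Homology

/-! ### The Vietoris–Rips complex -/

/-- The Vietoris–Rips complex `R({x_i}; r)` of the points `x i`: a nonempty finite set of
points spans a face if the closed balls of radius `r / 2` about its points meet pairwise. -/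
def ripsComplex {ι E : Type*} [PseudoMetricSpace E] (x : ι → E) (r : ℝ) :
    AbstractSimplicialComplex ι where
  faces := {s | s.Nonempty ∧ (s : Set ι).Pairwise fun i j =>
    (Metric.closedBall (x i) (r / 2) ∩ Metric.closedBall (x j) (r / 2)).Nonempty}
  isRelLowerSet_faces := fun _ hs =>
    ⟨hs.1, fun _ hts ht => ⟨ht, hs.2.mono (Finset.coe_subset.mpr hts)⟩⟩
  singleton_mem v := ⟨Finset.singleton_nonempty v, by simp⟩

/-! ### Components isomorphic to the boundary of the cross-polytope -/

/-- The boundary complex `O_k` of the `(k+1)`-dimensional cross-polytope. The vertices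
`(i, true)`, `(i, false)` stand for `e_i`, `-e_i`; the faces are the nonempty sets of vertices
that contain no antipodal pair. -/
def crossPolytopeBoundary (k : ℕ) : AbstractSimplicialComplex (Fin (k + 1) × Bool) where
  faces := {s | s.Nonempty ∧ ∀ i, ¬((i, true) ∈ s ∧ (i, false) ∈ s)}
  isRelLowerSet_faces := fun _ hs =>
    ⟨hs.1, fun _ hts ht => ⟨ht, fun i hi => hs.2 i ⟨hts hi.1, hts hi.2⟩⟩⟩
  singleton_mem v := ⟨Finset.singleton_nonempty v, by
    rintro i ⟨h1, h2⟩
    rw [Finset.mem_singleton] at h1 h2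
    simpa using h1.trans h2.symm⟩

/-- Combinatorial isomorphism of simplicial complexes. -/
def Isomorphic {V W : Type*} (K : AbstractSimplicialComplex V)
    (L : AbstractSimplicialComplex W) : Prop :=
  ∃ e : V ≃ W, ∀ s : Finset V, s ∈ K.faces ↔ s.map e.toEmbedding ∈ L.faces

/-- The subcomplex of `K` induced on a set `S` of vertices. -/
def inducedSubcomplex {V : Type*} (K : AbstractSimplicialComplex V) (S : Set V) :
    AbstractSimplicialComplex S where
  faces := {s | s.map (Function.Embedding.subtype (· ∈ S)) ∈ K.faces}
  isRelLowerSet_faces := fun _ hs =>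
    ⟨Finset.map_nonempty.mp (K.isRelLowerSet_faces hs).1, fun _ hts ht =>
      (K.isRelLowerSet_faces hs).2 (Finset.map_subset_map.mpr hts) (Finset.map_nonempty.mpr ht)⟩
  singleton_mem v := by simpa using K.singleton_mem (v : V)

/-- The `1`-skeleton of a simplicial complex, as a graph. -/
def oneSkeleton {V : Type*} [DecidableEq V] (K : AbstractSimplicialComplex V) :
    SimpleGraph V where
  Adj u v := u ≠ v ∧ {u, v} ∈ K.faces
  symm := ⟨fun u v h => ⟨h.1.symm, by rw [Finset.pair_comm]; exact h.2⟩⟩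
  loopless := ⟨fun _ h => h.1 rfl⟩

/-- The number of connected components of `K` that are isomorphic to `O_k`. -/
def crossPolytopeComponents {V : Type*} [DecidableEq V] (K : AbstractSimplicialComplex V)
    (k : ℕ) : ℕ :=
  Nat.card {c : (oneSkeleton K).ConnectedComponent //
    Isomorphic (inducedSubcomplex K c.supp) (crossPolytopeBoundary k)}

end RandomRips

end

set_option linter.unusedSectionVars false

/-! The argument sandwiches both the Betti number and the component count between quantities whose
expectations can be computed.

Topology. In a flag complex every vertex `v` gives a deletion and a link, and a cycle can be pushed
off `v` once its link part bounds in the link (`cyclesBound_of_link`). A vertex with a non-neighbor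
has a link smaller by at least two vertices, so by induction fewer than `2 * m` vertices cannot
carry reduced homology on `m`-cliques (`cyclesBound_of_card_lt`). With exactly `2 * m` vertices the
same induction fails only if each vertex has exactly one non-neighbor, which is the cross-polytope
boundary, and there the top cycles form a line (`IsAntipodal.exists_cycle`). Homology splits over
components. Hence for `k ≥ 1` each cross-polytope component contributes one to the Betti number, the
other components with at most `2 * k + 2` vertices contribute nothing, and larger components
contribute at most their number of `k`-faces.

Counting. Every such face in a large component, and every cross-polytope vertex set that is not a
whole component, extends to `2 * k + 3` points within pairwise distance `(2 * k + 3) * r`. Up to a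
constant times the number of such clusters, the Betti number, the number of cross-polytope
components and the number of cross-polytope subgraphs therefore agree (`ripsComplex_counts`).

Probability. The expected number of subgraphs is a binomial coefficient times the probability that
`2 * k + 2` points form an antipodal configuration. Fixing one point and rescaling the others by `r`
turns this event into a fixed set of shapes; continuity of translation in `L¹` and dominated
convergence give the limit (`tendsto_pi_withDensity_div`). The constant is `∫ f ^ (2 * k + 2)` times
the volume of the shapes, over `(2 * k + 2)!`; it is positive because antipodal shapes contain a
nonempty open set (`volume_antipodalShapes_pos`). The expected number of clusters is smaller by a
factor of order `n * r ^ d`, which tends to zero in this regime, so `tendsto_div_of_sandwich` gives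
both limits. -/

namespace RandomRips

/-! ### Reduced homology of small flag complexes -/

section Chains

variable (F : Type*) [Field F] {V : Type*} [LinearOrder V]

/-- Coning off with apex `v`: this sends a simplex `s` not containing `v` to `± (insert v s)`. -/
noncomputable def cone (v : V) : (Finset V →₀ F) →ₗ[F] (Finset V →₀ F) :=
  Finsupp.linearCombination F fun s : Finset V =>
    if v ∈ s then 0 else Finsupp.single (insert v s) (vertexSign F (insert v s) v)

/-- The link part at `v`: this sends a simplex `s` containing `v` to `± (s.erase v)`. -/
noncomputable def linkPart (v : V) : (Finset V →₀ F) →ₗ[F] (Finset V →₀ F) :=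
  Finsupp.linearCombination F fun s : Finset V =>
    if v ∈ s then Finsupp.single (s.erase v) (vertexSign F s v) else 0

variable {F}

theorem cone_single (v : V) (s : Finset V) :
    cone F v (Finsupp.single s 1) =
      if v ∈ s then 0 else Finsupp.single (insert v s) (vertexSign F (insert v s) v) := by
  simp [cone]

theorem linkPart_single (v : V) (s : Finset V) :
    linkPart F v (Finsupp.single s 1) =
      if v ∈ s then Finsupp.single (s.erase v) (vertexSign F s v) else 0 := by
  simp [linkPart]

theorem vertexSign_mul_self (s : Finset V) (v : V) : vertexSign F s v * vertexSign F s v = 1 := by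
  rw [vertexSign, ← mul_pow]; simp

theorem vertexSign_swap_of_ne (s : Finset V) {v w : V} (hv : v ∈ s) (hw : w ∈ s) (h : v ≠ w) :
    vertexSign F s v * vertexSign F (s.erase v) w
      + vertexSign F s w * vertexSign F (s.erase w) v = 0 := by
  rcases lt_or_gt_of_ne h with h | h
  · exact vertexSign_swap F s hv h
  · rw [add_comm]; exact vertexSign_swap F s hw h

theorem map_single_eq_smul (φ : (Finset V →₀ F) →ₗ[F] (Finset V →₀ F)) (s : Finset V) (a : F) :
    φ (Finsupp.single s a) = a • φ (Finsupp.single s 1) := by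
  rw [← map_smul, Finsupp.smul_single, smul_eq_mul, mul_one]

/-- Coning is a contracting homotopy of the full simplex: terms that remove a vertex other than `v`
cancel in pairs, and only the term that removes `v` survives. -/
theorem boundary_cone_add (v : V) (c : Finset V →₀ F) :
    boundary F (cone F v c) + cone F v (boundary F c) = c := by
  suffices h : boundary F ∘ₗ cone F v + cone F v ∘ₗ boundary F = LinearMap.id from
    LinearMap.congr_fun h c
  refine Finsupp.lhom_ext' fun s => LinearMap.ext_ring ?_
  simp only [LinearMap.comp_apply, Finsupp.lsingle_apply, LinearMap.add_apply, LinearMap.id_apply]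
  rw [cone_single, boundary_single, map_sum]
  split_ifs with hv
  · rw [map_zero, zero_add, Finset.sum_eq_single_of_mem v hv]
    · rw [map_single_eq_smul, cone_single, if_neg (Finset.notMem_erase v s),
        Finset.insert_erase hv, Finsupp.smul_single, smul_eq_mul, vertexSign_mul_self]
    · intro w _ hwv
      rw [map_single_eq_smul, cone_single, if_pos (Finset.mem_erase.2 ⟨hwv.symm, hv⟩), smul_zero]
  · rw [map_single_eq_smul, boundary_single, Finset.sum_insert hv, Finset.erase_insert hv, smul_add,
      Finsupp.smul_single, smul_eq_mul, vertexSign_mul_self, add_assoc, Finset.smul_sum,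
      ← Finset.sum_add_distrib, Finset.sum_eq_zero, add_zero]
    intro w hw
    have hvw : v ≠ w := fun h => hv (h ▸ hw)
    rw [map_single_eq_smul _ (s.erase w), cone_single,
      if_neg (fun h => hv (Finset.mem_of_mem_erase h)), Finsupp.smul_single, Finsupp.smul_single,
      Finset.erase_insert_of_ne hvw, ← Finsupp.single_add, smul_eq_mul, smul_eq_mul]
    -- Removing `v` and `w` from `insert v s` in the two orders gives opposite signs; since signs
    -- square to one, this can be solved for the required cancellation.
    have key := vertexSign_swap_of_ne (F := F) (insert v s) (Finset.mem_insert_self v s)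
      (Finset.mem_insert_of_mem hw) hvw
    rw [Finset.erase_insert hv, Finset.erase_insert_of_ne hvw] at key
    have h1 := vertexSign_mul_self (F := F) (insert v s) w
    have h2 := vertexSign_mul_self (F := F) s w
    refine (congrArg _ ?_).trans (Finsupp.single_zero _)
    linear_combination (vertexSign F (insert v s) w * vertexSign F s w) * key
      - vertexSign F (insert v s) v * vertexSign F (insert v s) w * h2
      - vertexSign F s w * vertexSign F (insert v (s.erase w)) v * h1

/-- The two summands are the projections onto simplices that contain `v` and simplices that avoid
it. -/
theorem cone_linkPart_add (v : V) (c : Finset V →₀ F) :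
    cone F v (linkPart F v c) + linkPart F v (cone F v c) = c := by
  suffices h : cone F v ∘ₗ linkPart F v + linkPart F v ∘ₗ cone F v = LinearMap.id from
    LinearMap.congr_fun h c
  refine Finsupp.lhom_ext' fun s => LinearMap.ext_ring ?_
  simp only [LinearMap.comp_apply, Finsupp.lsingle_apply, LinearMap.add_apply, LinearMap.id_apply]
  rw [cone_single, linkPart_single]
  split_ifs with hv
  · rw [map_zero, add_zero, map_single_eq_smul, cone_single, if_neg (Finset.notMem_erase v s),
      Finset.insert_erase hv, Finsupp.smul_single, smul_eq_mul, vertexSign_mul_self]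
  · rw [map_zero, zero_add, map_single_eq_smul, linkPart_single,
      if_pos (Finset.mem_insert_self v s), Finset.erase_insert hv, Finsupp.smul_single, smul_eq_mul,
      vertexSign_mul_self]

/-- Anticommutation, from the same sign rule, makes the link part of a cycle a cycle. -/
theorem boundary_linkPart_add (v : V) (c : Finset V →₀ F) :
    boundary F (linkPart F v c) + linkPart F v (boundary F c) = 0 := by
  suffices h : boundary F ∘ₗ linkPart F v + linkPart F v ∘ₗ boundary F = 0 from
    LinearMap.congr_fun h c
  refine Finsupp.lhom_ext' fun s => LinearMap.ext_ring ?_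
  simp only [LinearMap.comp_apply, Finsupp.lsingle_apply, LinearMap.add_apply,
    LinearMap.zero_apply]
  rw [linkPart_single, boundary_single, map_sum]
  split_ifs with hv
  · rw [map_single_eq_smul, boundary_single, Finset.smul_sum,
      ← Finset.add_sum_erase s (fun w => linkPart F v (Finsupp.single (s.erase w) _)) hv,
      map_single_eq_smul _ (s.erase v), linkPart_single, if_neg (Finset.notMem_erase v s),
      smul_zero, zero_add, ← Finset.sum_add_distrib, Finset.sum_eq_zero]
    intro w hw
    obtain ⟨hwv, hw⟩ := Finset.mem_erase.1 hw
    rw [map_single_eq_smul _ (s.erase w), linkPart_single,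
      if_pos (Finset.mem_erase.2 ⟨hwv.symm, hv⟩), Finsupp.smul_single, Finsupp.smul_single,
      Finset.erase_right_comm (a := w), ← Finsupp.single_add, smul_eq_mul, smul_eq_mul,
      vertexSign_swap_of_ne s hv hw hwv.symm, Finsupp.single_zero]
  · rw [map_zero, zero_add, Finset.sum_eq_zero]
    intro w _
    rw [map_single_eq_smul, linkPart_single, if_neg (fun h => hv (Finset.mem_of_mem_erase h)),
      smul_zero]

theorem map_mem_supported {A B : Set (Finset V)}
    (φ : (Finset V →₀ F) →ₗ[F] (Finset V →₀ F))
    (h : ∀ s ∈ A, φ (Finsupp.single s 1) ∈ Finsupp.supported F F B)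
    {c : Finset V →₀ F} (hc : c ∈ Finsupp.supported F F A) : φ c ∈ Finsupp.supported F F B := by
  have : Finsupp.supported F F A ≤ (Finsupp.supported F F B).comap φ := by
    rw [Finsupp.supported_eq_span_single, Submodule.span_le]
    rintro _ ⟨s, hs, rfl⟩
    exact h s hs
  exact this hc

variable (F) in
/-- The chains on the cliques with `m` vertices of the graph induced on `S`. -/
def cliqueChains (G : SimpleGraph V) (S : Finset V) (m : ℕ) : Submodule F (Finset V →₀ F) :=
  Finsupp.supported F F {s | s ⊆ S ∧ G.IsClique s ∧ s.card = m}

variable {G : SimpleGraph V} {S L : Finset V} {m : ℕ} {v : V}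

theorem cliqueChains_mono (h : L ⊆ S) : cliqueChains F G L m ≤ cliqueChains F G S m :=
  Finsupp.supported_mono fun _ hs => ⟨hs.1.trans h, hs.2⟩

theorem cliqueChains_eq_bot (h : ∀ s ⊆ S, G.IsClique s → s.card ≠ m) :
    cliqueChains F G S m = ⊥ := by
  rw [cliqueChains, ← Finsupp.supported_empty]
  congr 1
  ext s
  simpa using h s

theorem cone_mem_cliqueChains (hv : v ∈ S) (hL : ∀ u ∈ L, u ∈ S ∧ (u ≠ v → G.Adj v u))
    {c : Finset V →₀ F} (hc : c ∈ cliqueChains F G L m) :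
    cone F v c ∈ cliqueChains F G S (m + 1) := by
  refine map_mem_supported _ ?_ hc
  rintro s ⟨hsS, hs, hcard⟩
  rw [cone_single]
  split_ifs with hvs
  · exact Submodule.zero_mem _
  · refine Finsupp.single_mem_supported F _
      ⟨Finset.insert_subset hv fun u hu => (hL u (hsS hu)).1, ?_, ?_⟩
    · rw [Finset.coe_insert, SimpleGraph.isClique_insert]
      exact ⟨hs, fun u hu hvu => (hL u (hsS hu)).2 hvu.symm⟩
    · rw [Finset.card_insert_of_notMem hvs, hcard]

theorem linkPart_mem_cliqueChains [DecidableRel G.Adj] {c : Finset V →₀ F}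
    (hc : c ∈ cliqueChains F G S (m + 1)) :
    linkPart F v c ∈ cliqueChains F G (S.filter (G.Adj v)) m := by
  refine map_mem_supported _ ?_ hc
  rintro s ⟨hsS, hs, hcard⟩
  rw [linkPart_single]
  split_ifs with hvs
  · refine Finsupp.single_mem_supported F _ ⟨fun u hu => ?_,
      hs.subset (Finset.coe_subset.2 (Finset.erase_subset v s)), ?_⟩
    · obtain ⟨huv, hu⟩ := Finset.mem_erase.1 hu
      exact Finset.mem_filter.2 ⟨hsS hu, hs hvs hu huv.symm⟩
    · rw [Finset.card_erase_of_mem hvs, hcard]; rfl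
  · exact Submodule.zero_mem _

theorem linkPart_cone_mem_cliqueChains {c : Finset V →₀ F}
    (hc : c ∈ cliqueChains F G S m) :
    linkPart F v (cone F v c) ∈ cliqueChains F G (S.erase v) m := by
  refine map_mem_supported (linkPart F v ∘ₗ cone F v) ?_ hc
  rintro s ⟨hsS, hs⟩
  rw [LinearMap.comp_apply, cone_single]
  split_ifs with hvs
  · rw [map_zero]; exact Submodule.zero_mem _
  · rw [map_single_eq_smul, linkPart_single, if_pos (Finset.mem_insert_self v s),
      Finset.erase_insert hvs]
    refine Submodule.smul_mem _ _ (Finsupp.single_mem_supported F _ ⟨?_, hs⟩)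
    exact fun u hu => Finset.mem_erase.2 ⟨fun h => hvs (h ▸ hu), hsS hu⟩

theorem linkPart_eq_zero {c : Finset V →₀ F} (hc : c ∈ cliqueChains F G S m) (hv : v ∉ S) :
    linkPart F v c = 0 := by
  have : linkPart F v c ∈ Finsupp.supported F F (∅ : Set (Finset V)) := by
    refine map_mem_supported _ ?_ hc
    rintro s ⟨hsS, -⟩
    rw [linkPart_single, if_neg (fun h => hv (hsS h))]
    exact Submodule.zero_mem _
  simpa using this

variable (F G) in
/-- The cycles on `m`-cliques in `S` are boundaries of chains on `m + 1`-cliques in `S`. -/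
def CyclesBound (S : Finset V) (m : ℕ) : Prop :=
  ∀ z ∈ cliqueChains F G S m, boundary F z = 0 → ∃ w ∈ cliqueChains F G S (m + 1), boundary F w = z

/-- The complex is a cone with apex `v`, so coning a cycle fills it. -/
theorem cyclesBound_of_dominating (hv : v ∈ S) (h : ∀ u ∈ S, u ≠ v → G.Adj v u) :
    CyclesBound F G S m := fun z hz hz0 =>
  ⟨cone F v z, cone_mem_cliqueChains hv (fun u hu => ⟨hu, h u hu⟩) hz, by
    simpa [hz0] using boundary_cone_add v z⟩

/-- A Mayer–Vietoris step for the star and the deletion of `v`. If `c` fills the link part of `z`,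
adding the boundary of the cone over `c` cancels every simplex of `z` through `v`, leaving a
homologous cycle in the deletion. -/
theorem cyclesBound_of_link [DecidableRel G.Adj] (hv : v ∈ S)
    (hlink : CyclesBound F G (S.filter (G.Adj v)) m)
    (hdel : CyclesBound F G (S.erase v) (m + 1)) : CyclesBound F G S (m + 1) := by
  intro z hz hz0
  obtain ⟨c, hc, hcz⟩ := hlink (linkPart F v z) (linkPart_mem_cliqueChains hz) (by
    simpa [hz0] using boundary_linkPart_add v z)
  have hcone : cone F v c ∈ cliqueChains F G S (m + 1 + 1) :=
    cone_mem_cliqueChains hv (fun u hu => ⟨(Finset.mem_filter.1 hu).1,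
      fun _ => (Finset.mem_filter.1 hu).2⟩) hc
  have e1 := boundary_cone_add v c
  have e2 := cone_linkPart_add v z
  rw [hcz] at e1
  have e3 : z + boundary F (cone F v c) = linkPart F v (cone F v z) + c := by
    rw [← eq_sub_iff_add_eq] at e1 e2
    rw [e1]; nth_rewrite 1 [← cone_linkPart_add v z]; abel
  obtain ⟨w, hw, hwz⟩ := hdel (z + boundary F (cone F v c)) (by
    rw [e3]
    refine Submodule.add_mem _ (linkPart_cone_mem_cliqueChains hz)
      (cliqueChains_mono (fun u hu => ?_) hc)
    obtain ⟨hu, huv⟩ := Finset.mem_filter.1 hu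
    exact Finset.mem_erase.2 ⟨huv.ne', hu⟩) (by
    rw [map_add, hz0, boundary_boundary, add_zero])
  refine ⟨w - cone F v c, Submodule.sub_mem _
    (cliqueChains_mono (Finset.erase_subset v S) hw) hcone, ?_⟩
  rw [map_sub, hwz, add_sub_cancel_right]

/-- The vertices of `S` other than `v` not adjacent to `v`. -/
def nonNeighbors (G : SimpleGraph V) [DecidableRel G.Adj] (S : Finset V) (v : V) : Finset V :=
  (S.erase v).filter fun u => ¬G.Adj v u

theorem card_link_add [DecidableRel G.Adj] (hv : v ∈ S) :
    (S.filter (G.Adj v)).card + (nonNeighbors G S v).card + 1 = S.card := by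
  have : S.filter (G.Adj v) = (S.erase v).filter (G.Adj v) := by
    rw [Finset.filter_erase, Finset.erase_eq_of_notMem (by simp)]
  rw [this, nonNeighbors, Finset.card_filter_add_card_filter_not, Finset.card_erase_add_one hv]

theorem dominating_of_card_nonNeighbors_eq_zero [DecidableRel G.Adj]
    (h : (nonNeighbors G S v).card = 0) : ∀ u ∈ S, u ≠ v → G.Adj v u := by
  intro u hu huv
  by_contra hn
  have : u ∈ nonNeighbors G S v := by simp [nonNeighbors, hu, huv, hn]
  rw [Finset.card_eq_zero.1 h] at this
  simp at this

/-- A flag complex with fewer than `2 m` vertices has no reduced homology on `m`-cliques. -/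
theorem cyclesBound_of_card_lt (G : SimpleGraph V) (S : Finset V) (m : ℕ) (h : S.card < 2 * m) :
    CyclesBound F G S m := by
  classical
  induction hn : S.card using Nat.strong_induction_on generalizing S m with
  | _ n ih =>
    obtain ⟨m, rfl⟩ : ∃ m', m = m' + 1 := ⟨m - 1, by omega⟩
    rcases S.eq_empty_or_nonempty with rfl | ⟨v, hv⟩
    · intro z hz _
      rw [cliqueChains_eq_bot (fun s hs _ => by simp [Finset.subset_empty.1 hs])] at hz
      exact ⟨0, Submodule.zero_mem _, by rw [map_zero, (Submodule.mem_bot F).1 hz]⟩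
    · have hcard := card_link_add (G := G) hv
      by_cases h0 : (nonNeighbors G S v).card = 0
      · exact cyclesBound_of_dominating hv (dominating_of_card_nonNeighbors_eq_zero h0)
      -- The link loses at least two vertices while `m` drops by one; the deletion loses one vertex
      -- with `m` unchanged. Both stay below the threshold.
      · have he := Finset.card_erase_add_one hv
        exact cyclesBound_of_link hv (ih _ (by omega) _ _ (by omega) rfl)
          (ih _ (by omega) _ _ (by omega) rfl)

/-- Every vertex of `S` has exactly one non-neighbor in `S`. -/
def IsAntipodal (G : SimpleGraph V) [DecidableRel G.Adj] (S : Finset V) : Prop :=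
  ∀ v ∈ S, (nonNeighbors G S v).card = 1

/-- At the critical size some vertex has either no non-neighbor, and the complex is a cone, or at
least two, and then its link and its deletion are both below the threshold of
`cyclesBound_of_card_lt`. -/
theorem cyclesBound_of_not_isAntipodal [DecidableRel G.Adj] (h : S.card ≤ 2 * m)
    (hS : ¬(IsAntipodal G S ∧ S.card = 2 * m)) : CyclesBound F G S m := by
  rcases h.lt_or_eq with h | h
  · exact cyclesBound_of_card_lt G S m h
  have : ∃ v ∈ S, (nonNeighbors G S v).card ≠ 1 := by
    by_contra! hcon
    exact hS ⟨hcon, h⟩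
  obtain ⟨v, hv, hne⟩ := this
  have hpos : 0 < S.card := Finset.card_pos.2 ⟨v, hv⟩
  obtain ⟨m, rfl⟩ : ∃ m', m = m' + 1 := ⟨m - 1, by omega⟩
  have hcard := card_link_add (G := G) hv
  have he := Finset.card_erase_add_one hv
  by_cases h0 : (nonNeighbors G S v).card = 0
  · exact cyclesBound_of_dominating hv (dominating_of_card_nonNeighbors_eq_zero h0)
  · exact cyclesBound_of_link hv (cyclesBound_of_card_lt _ _ _ (by omega))
      (cyclesBound_of_card_lt _ _ _ (by omega))

/-- The non-neighbor of a neighbor `u` of `v` is itself adjacent to `v`: otherwise it would have the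
two distinct non-neighbors `u` and `v`. So passing to the link keeps every antipode. -/
theorem IsAntipodal.link [DecidableRel G.Adj] (hS : IsAntipodal G S) (hv : v ∈ S) :
    IsAntipodal G (S.filter (G.Adj v)) := by
  intro u hu
  obtain ⟨hu, hvu⟩ := Finset.mem_filter.1 hu
  rw [← hS u hu]
  congr 1
  ext x
  simp only [nonNeighbors, Finset.mem_filter, Finset.mem_erase]
  refine ⟨fun h => ⟨⟨h.1.1, h.1.2.1⟩, h.2⟩, fun h => ⟨⟨h.1.1, h.1.2, ?_⟩, h.2⟩⟩
  by_contra hvx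
  have hxv : x ≠ v := fun hxv => h.2 (hxv ▸ hvu.symm)
  obtain ⟨y, hy⟩ := Finset.card_eq_one.1 (hS x h.1.2)
  have h1 : u ∈ nonNeighbors G S x := by
    simp only [nonNeighbors, Finset.mem_filter, Finset.mem_erase]
    exact ⟨⟨h.1.1.symm, hu⟩, fun h' => h.2 h'.symm⟩
  have h2 : v ∈ nonNeighbors G S x := by
    simp only [nonNeighbors, Finset.mem_filter, Finset.mem_erase]
    exact ⟨⟨hxv.symm, hv⟩, fun h' => hvx h'.symm⟩
  rw [hy, Finset.mem_singleton] at h1 h2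
  exact hvu.ne (h2.trans h1.symm)

/-- A clique is disjoint from the set of its antipodes, which has the same size and also lies in
`S`. -/
theorem IsAntipodal.card_clique_le [DecidableRel G.Adj] (hS : IsAntipodal G S)
    (hcard : S.card = 2 * m) {t : Finset V} (ht : t ⊆ S) (hcl : G.IsClique t) : t.card ≤ m := by
  choose! g hg using fun v hv => Finset.card_eq_one.1 (hS v hv)
  have hgmem : ∀ v ∈ S, g v ∈ S ∧ g v ≠ v ∧ ¬G.Adj v (g v) := by
    intro v hv
    have : g v ∈ nonNeighbors G S v := by rw [hg v hv]; exact Finset.mem_singleton_self _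
    simp only [nonNeighbors, Finset.mem_filter, Finset.mem_erase] at this
    exact ⟨this.1.2, this.1.1, this.2⟩
  have hgg : ∀ v ∈ S, g (g v) = v := by
    intro v hv
    obtain ⟨h1, h2, h3⟩ := hgmem v hv
    have : v ∈ nonNeighbors G S (g v) := by
      simp only [nonNeighbors, Finset.mem_filter, Finset.mem_erase]
      exact ⟨⟨h2.symm, hv⟩, fun h => h3 h.symm⟩
    rw [hg _ h1, Finset.mem_singleton] at this
    exact this.symm
  have hinj : Set.InjOn g t := fun a ha b hb hab => by
    rw [← hgg a (ht ha), hab, hgg b (ht hb)]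
  have hdisj : Disjoint t (t.image g) := by
    rw [Finset.disjoint_left]
    intro a ha hb
    obtain ⟨b, hbt, rfl⟩ := Finset.mem_image.1 hb
    obtain ⟨h1, h2, h3⟩ := hgmem b (ht hbt)
    exact h3 (hcl hbt ha h2.symm)
  have hsub : t ∪ t.image g ⊆ S := Finset.union_subset ht fun a ha => by
    obtain ⟨b, hb, rfl⟩ := Finset.mem_image.1 ha
    exact (hgmem b (ht hb)).1
  have := Finset.card_le_card hsub
  rw [Finset.card_union_of_disjoint hdisj, Finset.card_image_of_injOn hinj] at this
  omega

/-- The fundamental cycle of a cross-polytope boundary spans the space of top cycles. -/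
theorem IsAntipodal.exists_cycle [DecidableRel G.Adj] (hS : IsAntipodal G S)
    (hcard : S.card = 2 * m) :
    ∃ z ∈ cliqueChains F G S m, boundary F z = 0 ∧ z ≠ 0 ∧
      ∀ y ∈ cliqueChains F G S m, boundary F y = 0 → ∃ a : F, y = a • z := by
  induction m generalizing S with
  | zero =>
    -- Chains are augmented, so the empty simplex is the generating cycle of the empty
    -- cross-polytope.
    have hS0 : S = ∅ := Finset.card_eq_zero.1 (by omega)
    subst hS0
    refine ⟨Finsupp.single ∅ 1, Finsupp.single_mem_supported F _ (by simp),
      by simp [boundary_single], by simp, fun y hy _ => ⟨y ∅, ?_⟩⟩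
    ext s
    by_cases hs : s = ∅
    · simp [hs]
    · have : y s = 0 := by
        rw [cliqueChains, Finsupp.mem_supported'] at hy
        exact hy s fun h => hs (Finset.subset_empty.1 h.1)
      simp [this, Ne.symm hs]
  | succ m ih =>
    obtain ⟨v, hv⟩ : S.Nonempty := Finset.card_pos.1 (by omega)
    obtain ⟨w, hw⟩ := Finset.card_eq_one.1 (hS v hv)
    have hwmem : w ∈ nonNeighbors G S v := by rw [hw]; exact Finset.mem_singleton_self _
    simp only [nonNeighbors, Finset.mem_filter, Finset.mem_erase] at hwmem
    obtain ⟨⟨hwv, hwS⟩, hvw⟩ := hwmem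
    have hcl := card_link_add (G := G) hv
    rw [hS v hv] at hcl
    obtain ⟨z, hz, hz0, hzne, hspan⟩ := ih (hS.link hv) (by omega)
    have hvl : v ∉ S.filter (G.Adj v) := by simp
    have hwl : ∀ u ∈ S.filter (G.Adj v), u ∈ S ∧ (u ≠ w → G.Adj w u) := by
      intro u hu
      obtain ⟨hu, hvu⟩ := Finset.mem_filter.1 hu
      refine ⟨hu, fun huw => ?_⟩
      by_contra hn
      obtain ⟨y, hy⟩ := Finset.card_eq_one.1 (hS w hwS)
      have h1 : u ∈ nonNeighbors G S w := by
        simp only [nonNeighbors, Finset.mem_filter, Finset.mem_erase]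
        exact ⟨⟨huw, hu⟩, hn⟩
      have h2 : v ∈ nonNeighbors G S w := by
        simp only [nonNeighbors, Finset.mem_filter, Finset.mem_erase]
        exact ⟨⟨hwv.symm, hv⟩, fun h => hvw h.symm⟩
      rw [hy, Finset.mem_singleton] at h1 h2
      exact hvu.ne (h2.trans h1.symm)
    have hdom : ∀ u ∈ S.erase v, u ∈ S.erase v ∧ (u ≠ w → G.Adj w u) := by
      intro u hu
      refine ⟨hu, fun huw => (hwl u (Finset.mem_filter.2 ⟨Finset.mem_of_mem_erase hu, ?_⟩)).2 huw⟩
      by_contra hn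
      have : u ∈ nonNeighbors G S v := by
        simp only [nonNeighbors, Finset.mem_filter]
        exact ⟨hu, hn⟩
      rw [hw, Finset.mem_singleton] at this
      exact huw this
    have hconev : cone F v z ∈ cliqueChains F G S (m + 1) :=
      cone_mem_cliqueChains hv (fun u hu => ⟨(Finset.mem_filter.1 hu).1,
        fun _ => (Finset.mem_filter.1 hu).2⟩) hz
    have hconew : cone F w z ∈ cliqueChains F G (S.erase v) (m + 1) := by
      refine cone_mem_cliqueChains (Finset.mem_erase.2 ⟨hwv, hwS⟩) (fun u hu => ?_) hz
      exact ⟨Finset.mem_erase.2 ⟨fun h => hvl (h ▸ hu), (hwl u hu).1⟩, (hwl u hu).2⟩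
    have hlink : linkPart F v (cone F v z - cone F w z) = z := by
      have h1 := cone_linkPart_add v z
      rw [linkPart_eq_zero hz hvl, map_zero, zero_add] at h1
      rw [map_sub, h1, linkPart_eq_zero hconew (Finset.notMem_erase v S), sub_zero]
    have hcycle : boundary F (cone F v z - cone F w z) = 0 := by
      have h1 := boundary_cone_add v z
      have h2 := boundary_cone_add w z
      rw [hz0, map_zero, add_zero] at h1 h2
      rw [map_sub, h1, h2, sub_self]
    have hmem : cone F v z - cone F w z ∈ cliqueChains F G S (m + 1) :=
      Submodule.sub_mem _ hconev (cliqueChains_mono (Finset.erase_subset v S) hconew)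
    -- The new cycle is the suspension of `z` with poles `v` and its antipode `w`; its link part at
    -- `v` recovers `z`, so it is nonzero.
    refine ⟨_, hmem, hcycle, fun h => hzne (by rw [← hlink, h, map_zero]), fun y hy hy0 => ?_⟩
    obtain ⟨a, ha⟩ := hspan (linkPart F v y) (linkPart_mem_cliqueChains hy) (by
      simpa [hy0] using boundary_linkPart_add v y)
    refine ⟨a, ?_⟩
    rw [← sub_eq_zero]
    -- The difference has no link part at `v`, so it is a cycle of the deletion, which is too small
    -- to carry homology. It bounds a chain on cliques with `m + 2` vertices, and there are none.
    set x := y - a • (cone F v z - cone F w z) with hx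
    have hxmem : x ∈ cliqueChains F G S (m + 1) :=
      Submodule.sub_mem _ hy (Submodule.smul_mem _ _ hmem)
    have hx0 : boundary F x = 0 := by rw [hx, map_sub, map_smul, hcycle, hy0]; simp
    have hxl : linkPart F v x = 0 := by rw [hx, map_sub, map_smul, hlink, ha, sub_self]
    have hxe : x ∈ cliqueChains F G (S.erase v) (m + 1) := by
      have h1 := cone_linkPart_add v x
      rw [hxl, map_zero, zero_add] at h1
      rw [← h1]
      exact linkPart_cone_mem_cliqueChains hxmem
    obtain ⟨u, hu, hux⟩ := cyclesBound_of_card_lt (F := F) G (S.erase v) (m + 1)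
      (by rw [Finset.card_erase_of_mem hv]; omega) x hxe hx0
    have := cliqueChains_mono (Finset.erase_subset v S) hu
    rw [cliqueChains_eq_bot fun s hs hcls => by
      have := hS.card_clique_le hcard hs hcls
      omega] at this
    rw [← hux, (Submodule.mem_bot F).1 this, map_zero]

end Chains

/-! ### Dimension bounds for subquotients -/

section Subquotient

variable {F : Type*} [Field F] {M W : Type*} [AddCommGroup M] [Module F M] [FiniteDimensional F M]
  [AddCommGroup W] [Module F W] [FiniteDimensional F W]

/-- Used to bound homology from above by coefficients that detect every nonbounding cycle: the
kernel of `φ` on `Z` lies in `B`. -/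
theorem finrank_subquotient_le (Z B : Submodule F M) (φ : M →ₗ[F] W)
    (h : ∀ z ∈ Z, φ z = 0 → z ∈ B) :
    Module.finrank F (Subquotient F Z B) ≤ Module.finrank F W := by
  have h1 := Submodule.finrank_quotient_add_finrank (B.submoduleOf Z)
  have h2 := LinearMap.finrank_range_add_finrank_ker (φ.domRestrict Z)
  have h3 : LinearMap.ker (φ.domRestrict Z) ≤ B.submoduleOf Z := fun z hz => h z z.2 hz
  have h4 := Submodule.finrank_mono h3
  have h5 := Submodule.finrank_le (LinearMap.range (φ.domRestrict Z))
  unfold Subquotient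
  omega

theorem le_finrank_subquotient (Z B : Submodule F M) (φ : M →ₗ[F] W)
    (hB : ∀ z ∈ B, φ z = 0) (hZ : ∀ w, ∃ z ∈ Z, φ z = w) :
    Module.finrank F W ≤ Module.finrank F (Subquotient F Z B) := by
  have h1 := Submodule.finrank_quotient_add_finrank (B.submoduleOf Z)
  have h2 := LinearMap.finrank_range_add_finrank_ker (φ.domRestrict Z)
  have h3 : B.submoduleOf Z ≤ LinearMap.ker (φ.domRestrict Z) := fun z hz => hB z hz
  have h4 := Submodule.finrank_mono h3
  have h5 : LinearMap.range (φ.domRestrict Z) = ⊤ := by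
    rw [LinearMap.range_eq_top]
    intro w
    obtain ⟨z, hz, rfl⟩ := hZ w
    exact ⟨⟨z, hz⟩, rfl⟩
  rw [h5, finrank_top] at h2
  unfold Subquotient
  omega

end Subquotient

/-! ### Splitting homology over connected components -/

section Components

variable {V : Type*} [Fintype V] [LinearOrder V] {G : SimpleGraph V}

open Classical in
/-- The vertex set of a connected component, as a finset. -/
noncomputable def componentFinset (c : G.ConnectedComponent) : Finset V :=
  Finset.univ.filter fun v => G.connectedComponentMk v = c

theorem mem_componentFinset {c : G.ConnectedComponent} {v : V} :
    v ∈ componentFinset c ↔ G.connectedComponentMk v = c := by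
  simp [componentFinset]

theorem clique_subset_componentFinset {s : Finset V} (hs : G.IsClique s) {v : V} (hv : v ∈ s) :
    s ⊆ componentFinset (G.connectedComponentMk v) := by
  intro u hu
  rw [mem_componentFinset, SimpleGraph.ConnectedComponent.eq]
  by_cases h : u = v
  · rw [h]
  · exact (hs hu hv h).reachable

variable (F : Type*) [Field F]

/-- The part of a chain on the simplices inside a vertex set. -/
noncomputable def restrictTo (S : Finset V) : (Finset V →₀ F) →ₗ[F] (Finset V →₀ F) :=
  Finsupp.linearCombination F fun s : Finset V => if s ⊆ S then Finsupp.single s 1 else 0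

variable {F}

theorem restrictTo_single (S s : Finset V) :
    restrictTo F S (Finsupp.single s 1) = if s ⊆ S then Finsupp.single s 1 else 0 := by
  simp [restrictTo]

theorem restrictTo_apply (S : Finset V) (z : Finset V →₀ F) (s : Finset V) :
    restrictTo F S z s = if s ⊆ S then z s else 0 := by
  suffices h : Finsupp.lapply s ∘ₗ restrictTo F S
      = (if s ⊆ S then (1 : F) else 0) • Finsupp.lapply s by
    have := LinearMap.congr_fun h z
    rw [LinearMap.comp_apply, LinearMap.smul_apply, Finsupp.lapply_apply, Finsupp.lapply_apply,
      smul_eq_mul] at this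
    rw [this]; split_ifs <;> simp
  refine Finsupp.lhom_ext' fun t => LinearMap.ext_ring ?_
  simp only [LinearMap.comp_apply, Finsupp.lsingle_apply, restrictTo_single, Finsupp.lapply_apply,
    LinearMap.smul_apply]
  by_cases hst : t = s
  · subst hst; split_ifs <;> simp
  · split_ifs <;> simp [hst]

theorem restrictTo_mem {S T : Finset V} {m : ℕ} {z : Finset V →₀ F}
    (hz : z ∈ cliqueChains F G T m) : restrictTo F S z ∈ cliqueChains F G S m := by
  refine map_mem_supported _ ?_ hz
  rintro s ⟨-, hs⟩
  rw [restrictTo_single]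
  split_ifs with h
  · exact Finsupp.single_mem_supported F _ ⟨h, hs⟩
  · exact Submodule.zero_mem _

/-- Cliques with at least two vertices stay in their component when a vertex is removed. -/
theorem boundary_restrictTo (c : G.ConnectedComponent) {T : Finset V} {k : ℕ}
    {z : Finset V →₀ F} (hz : z ∈ cliqueChains F G T (k + 2)) :
    boundary F (restrictTo F (componentFinset c) z)
      = restrictTo F (componentFinset c) (boundary F z) := by
  rw [← sub_eq_zero]
  suffices h : (boundary F ∘ₗ restrictTo F (componentFinset c)
      - restrictTo F (componentFinset c) ∘ₗ boundary F) z ∈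
      Finsupp.supported F F (∅ : Set (Finset V)) by simpa using h
  refine map_mem_supported _ ?_ hz
  rintro s ⟨-, hs, hcard⟩
  convert Submodule.zero_mem _
  rw [LinearMap.sub_apply, LinearMap.comp_apply, LinearMap.comp_apply, sub_eq_zero,
    restrictTo_single, boundary_single, map_sum]
  split_ifs with h
  · rw [boundary_single]
    refine Finset.sum_congr rfl fun w _ => ?_
    rw [map_single_eq_smul, restrictTo_single, if_pos ((Finset.erase_subset w s).trans h)]
    simp
  · rw [map_zero, eq_comm, Finset.sum_eq_zero]
    intro w hw
    rw [map_single_eq_smul, restrictTo_single, if_neg, smul_zero]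
    intro hsub
    obtain ⟨u, hu⟩ : (s.erase w).Nonempty := by
      rw [← Finset.card_pos, Finset.card_erase_of_mem hw]; omega
    apply h
    rw [← mem_componentFinset.1 (hsub hu)]
    exact clique_subset_componentFinset hs (Finset.mem_of_mem_erase hu)

/-- A nonempty clique lies in exactly one component; the empty simplex, excluded by `k + 1`, would
be counted in all of them. -/
theorem sum_restrictTo [Fintype G.ConnectedComponent] {T : Finset V} {k : ℕ} {z : Finset V →₀ F}
    (hz : z ∈ cliqueChains F G T (k + 1)) :
    ∑ c : G.ConnectedComponent, restrictTo F (componentFinset c) z = z := by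
  ext s
  rw [Finsupp.finsetSum_apply]
  simp only [restrictTo_apply]
  by_cases hs : z s = 0
  · simp [hs]
  have hmem : G.IsClique s ∧ s.card = k + 1 := by
    by_contra hn
    exact hs ((Finsupp.mem_supported' F z).1 hz s fun h => hn h.2)
  obtain ⟨v, hv⟩ : s.Nonempty := by rw [← Finset.card_pos]; omega
  rw [Finset.sum_eq_single_of_mem (G.connectedComponentMk v) (Finset.mem_univ _),
    if_pos (clique_subset_componentFinset hmem.1 hv)]
  intro c _ hc
  rw [if_neg]
  exact fun h => hc (mem_componentFinset.1 (h hv)).symm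

theorem chains_eq_cliqueChains {K : AbstractSimplicialComplex V}
    (hK : ∀ s, s ∈ K.faces ↔ s.Nonempty ∧ G.IsClique s) (k : ℕ) :
    chains F K k = cliqueChains F G Finset.univ (k + 1) := by
  rw [chains, cliqueChains]
  congr 1
  ext s
  simp only [Set.mem_ofPred_eq, hK, Finset.subset_univ, true_and]
  refine ⟨fun h => ⟨h.1.2, h.2⟩, fun h => ⟨⟨?_, h.1⟩, h.2⟩⟩
  rw [← Finset.card_pos]; omega

variable (G) in
open Classical in
/-- The `k`-simplices in components with at least `2 k + 3` vertices. -/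
noncomputable def facesInLargeComponents (k : ℕ) : Finset (Finset V) :=
  Finset.univ.filter fun s => G.IsClique s ∧ s.card = k + 1 ∧
    ∃ v ∈ s, 2 * k + 3 ≤ (componentFinset (G.connectedComponentMk v)).card

variable [DecidableRel G.Adj]

variable (G) in
/-- The components whose graph is that of a cross-polytope with `2 (k + 1)` vertices. -/
abbrev AntipodalComponent (k : ℕ) : Type _ :=
  {c : G.ConnectedComponent //
    IsAntipodal G (componentFinset c) ∧ (componentFinset c).card = 2 * (k + 1)}

-- Reading off one coefficient of each fundamental cycle separates classes. Boundaries have zero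
-- coefficient there because an antipodal component has no clique with `k + 2` vertices, and the
-- fundamental cycles realize all values because they live on different components.
variable (F) in
theorem card_antipodalComponent_le_betti {K : AbstractSimplicialComplex V}
    (hK : ∀ s, s ∈ K.faces ↔ s.Nonempty ∧ G.IsClique s) {k : ℕ} (hk : k ≠ 0) :
    Nat.card (AntipodalComponent G k) ≤ betti F K k := by
  classical
  choose z hz hz0 hzne _ using
    fun c : AntipodalComponent G k => c.2.1.exists_cycle (F := F) c.2.2
  choose s hs using fun c => Finsupp.ne_iff.1 (hzne c)
  simp only [Finsupp.coe_zero, Pi.zero_apply] at hs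
  have hsc : ∀ c, s c ⊆ componentFinset c.1 ∧ G.IsClique (s c) ∧ (s c).card = k + 1 := by
    intro c
    by_contra hn
    exact hs c ((Finsupp.mem_supported' F (z c)).1 (hz c) (s c) hn)
  rw [Nat.card_eq_fintype_card, ← Module.finrank_fintype_fun_eq_card F, betti]
  refine le_finrank_subquotient _ _ (LinearMap.pi fun c => Finsupp.lapply (s c)) ?_ ?_
  · rintro _ ⟨w, hw, rfl⟩
    rw [chains_eq_cliqueChains hK] at hw
    ext c
    have h1 : restrictTo F (componentFinset c.1) w = 0 := by
      have := restrictTo_mem (S := componentFinset c.1) hw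
      rwa [cliqueChains_eq_bot fun t ht hcl => by
        have := c.2.1.card_clique_le c.2.2 ht hcl
        omega, Submodule.mem_bot] at this
    have h2 := boundary_restrictTo c.1 hw
    rw [h1, map_zero] at h2
    have h3 := DFunLike.congr_fun h2 (s c)
    rw [restrictTo_apply, if_pos (hsc c).1] at h3
    simpa using h3.symm
  · intro w
    refine ⟨∑ c, (w c * (z c (s c))⁻¹) • z c, ?_, ?_⟩
    · rw [cycles, if_neg hk, chains_eq_cliqueChains hK]
      refine Submodule.sum_mem _ fun c _ => Submodule.smul_mem _ _
        ⟨cliqueChains_mono (Finset.subset_univ _) (hz c), hz0 c⟩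
    · ext c
      rw [LinearMap.pi_apply, Finsupp.lapply_apply, Finsupp.finsetSum_apply,
        Finset.sum_eq_single_of_mem c (Finset.mem_univ _)]
      · rw [Finsupp.smul_apply, smul_eq_mul, inv_mul_cancel_right₀ (hs c)]
      · intro c' _ hc'
        rw [Finsupp.smul_apply, (Finsupp.mem_supported' F (z c')).1 (hz c') (s c), smul_zero]
        rintro ⟨hsub, -⟩
        obtain ⟨v, hv⟩ : (s c).Nonempty := by rw [← Finset.card_pos, (hsc c).2.2]; omega
        have h1 := mem_componentFinset.1 ((hsc c).1 hv)
        have h2 := mem_componentFinset.1 (hsub hv)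
        exact hc' (Subtype.ext (h2.symm.trans h1))

-- A cycle bounds as soon as one chosen coefficient on each antipodal component and all coefficients
-- in large components vanish. Component by component, the restriction is zero, a zero multiple of
-- the fundamental cycle, or a cycle that bounds by `cyclesBound_of_not_isAntipodal`.
variable (F) in
theorem betti_le_card_antipodalComponent_add {K : AbstractSimplicialComplex V}
    (hK : ∀ s, s ∈ K.faces ↔ s.Nonempty ∧ G.IsClique s) {k : ℕ} (hk : k ≠ 0) :
    betti F K k ≤
      Nat.card (AntipodalComponent G k) + (facesInLargeComponents G k).card := by
  classical
  obtain ⟨k, rfl⟩ : ∃ j, k = j + 1 := ⟨k - 1, by omega⟩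
  choose z hz hz0 hzne hspan using
    fun c : AntipodalComponent G (k + 1) => c.2.1.exists_cycle (F := F) c.2.2
  choose s hs using fun c => Finsupp.ne_iff.1 (hzne c)
  simp only [Finsupp.coe_zero, Pi.zero_apply] at hs
  have hsc : ∀ c, s c ⊆ componentFinset c.1 := by
    intro c
    by_contra hn
    exact hs c ((Finsupp.mem_supported' F (z c)).1 (hz c) (s c) fun h => hn h.1)
  have hW : Module.finrank F ((AntipodalComponent G (k + 1) → F) × (facesInLargeComponents G (k + 1) → F))
      = Nat.card (AntipodalComponent G (k + 1)) + (facesInLargeComponents G (k + 1)).card := by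
    rw [Module.finrank_prod, Module.finrank_fintype_fun_eq_card, Module.finrank_fintype_fun_eq_card,
      Fintype.card_coe, Nat.card_eq_fintype_card]
  rw [← hW, betti]
  refine finrank_subquotient_le _ _ (LinearMap.prod (LinearMap.pi fun c => Finsupp.lapply (s c))
    (LinearMap.pi fun t => Finsupp.lapply (t : Finset V))) ?_
  intro y hy hy0
  rw [cycles, if_neg hk, chains_eq_cliqueChains hK] at hy
  obtain ⟨hyc, hyb⟩ := hy
  have hy1 : ∀ c, y (s c) = 0 := fun c => congr_fun (congr_arg Prod.fst hy0) c
  have hy2 : ∀ t ∈ facesInLargeComponents G (k + 1), y t = 0 := fun t ht =>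
    congr_fun (congr_arg Prod.snd hy0) ⟨t, ht⟩
  have hbound : ∀ c : G.ConnectedComponent, ∃ w ∈ chains F K (k + 1 + 1),
      boundary F w = restrictTo F (componentFinset c) y := by
    intro c
    rw [chains_eq_cliqueChains hK]
    have hmem := restrictTo_mem (S := componentFinset c) hyc
    have hcyc : boundary F (restrictTo F (componentFinset c) y) = 0 := by
      rw [boundary_restrictTo c hyc, LinearMap.mem_ker.1 hyb, map_zero]
    by_cases hbig : 2 * (k + 1) + 3 ≤ (componentFinset c).card
    · refine ⟨0, Submodule.zero_mem _, ?_⟩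
      rw [map_zero, eq_comm]
      ext t
      by_contra ht
      have ht' : t ⊆ componentFinset c ∧ G.IsClique t ∧ t.card = k + 1 + 1 := by
        by_contra hn
        exact ht ((Finsupp.mem_supported' F _).1 hmem t hn)
      rw [restrictTo_apply, if_pos ht'.1] at ht
      obtain ⟨v, hv⟩ : t.Nonempty := by rw [← Finset.card_pos]; omega
      refine ht (hy2 t ?_)
      simp only [facesInLargeComponents, Finset.mem_filter, Finset.mem_univ, true_and]
      refine ⟨ht'.2.1, ht'.2.2, v, hv, ?_⟩
      rwa [mem_componentFinset.1 (ht'.1 hv)]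
    by_cases hA : IsAntipodal G (componentFinset c) ∧
        (componentFinset c).card = 2 * (k + 1 + 1)
    · obtain ⟨a, ha⟩ := hspan ⟨c, hA⟩ _ hmem hcyc
      have h1 := DFunLike.congr_fun ha (s ⟨c, hA⟩)
      rw [restrictTo_apply, if_pos (hsc ⟨c, hA⟩), hy1, Finsupp.smul_apply, smul_eq_mul,
        eq_comm, mul_eq_zero, or_iff_left (hs ⟨c, hA⟩)] at h1
      rw [ha, h1, zero_smul]
      exact ⟨0, Submodule.zero_mem _, map_zero _⟩
    · obtain ⟨w, hw, hwy⟩ := cyclesBound_of_not_isAntipodal (by omega) hA _ hmem hcyc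
      exact ⟨w, cliqueChains_mono (Finset.subset_univ _) hw, hwy⟩
  choose w hw hwy using hbound
  refine ⟨∑ c, w c, Submodule.sum_mem _ fun c _ => hw c, ?_⟩
  rw [map_sum, Finset.sum_congr rfl fun c _ => hwy c, sum_restrictTo hyc]

end Components

/-! ### Recognizing the cross-polytope boundary -/

section CrossPolytope

/-- A fixed-point-free involution on `2 m` points is the antipodal map of a cross-polytope. -/
theorem exists_equiv_antipode {S : Type*} [Fintype S] [LinearOrder S] {m : ℕ} (g : S → S)
    (hgg : ∀ v, g (g v) = v) (hne : ∀ v, g v ≠ v) (hcard : Fintype.card S = 2 * m) :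
    ∃ e : S ≃ Fin m × Bool, ∀ v, e (g v) = ((e v).1, !(e v).2) := by
  classical
  have hinj : Function.Injective g := fun a b h => by rw [← hgg a, h, hgg]
  -- The order selects one vertex from each antipodal pair; these become the vertices with label
  -- `true`.
  set T : Finset S := Finset.univ.filter fun v => v < g v with hT
  have hT' : T.image g = Tᶜ := by
    ext v
    simp only [hT, Finset.mem_image, Finset.mem_filter, Finset.mem_univ, true_and,
      Finset.mem_compl, not_lt]
    constructor
    · rintro ⟨w, hw, rfl⟩
      rw [hgg]; exact hw.le
    · intro h
      exact ⟨g v, by rw [hgg]; exact lt_of_le_of_ne h (hne v), hgg v⟩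
  have hTc : T.card = m := by
    have h1 := Finset.card_compl_add_card T
    rw [← hT', Finset.card_image_of_injective _ hinj] at h1
    omega
  let t := (T.equivFinOfCardEq hTc).symm
  let φ : Fin m × Bool → S := fun p => if p.2 then t p.1 else g (t p.1)
  have htlt : ∀ i, (t i : S) < g (t i) := fun i => (Finset.mem_filter.1 (t i).2).2
  have hφ : Function.Injective φ := by
    have hti : ∀ i j, (t i : S) = t j → i = j := fun i j h => t.injective (Subtype.ext h)
    have hx : ∀ i j, (t i : S) ≠ g (t j) := fun i j h => by
      have h1 := htlt i
      rw [h, hgg] at h1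
      exact lt_asymm h1 (htlt j)
    rintro ⟨i, _ | _⟩ ⟨j, _ | _⟩ h
    · rw [hti i j (hinj (by simpa [φ] using h))]
    · exact absurd (by simpa [φ] using h.symm) (hx j i)
    · exact absurd (by simpa [φ] using h) (hx i j)
    · rw [hti i j (by simpa [φ] using h)]
  have hbij : Function.Bijective φ := by
    rw [Fintype.bijective_iff_injective_and_card]
    refine ⟨hφ, ?_⟩
    simp [hcard, mul_comm]
  have key : ∀ p : Fin m × Bool, g (φ p) = φ (p.1, !p.2) := by
    rintro ⟨i, _ | _⟩ <;> simp [φ, hgg]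
  refine ⟨(Equiv.ofBijective φ hbij).symm, fun v => ?_⟩
  rw [Equiv.symm_apply_eq, Equiv.ofBijective_apply, ← key, ← Equiv.ofBijective_apply φ hbij,
    Equiv.apply_symm_apply]

theorem mem_crossPolytopeBoundary {k : ℕ} {s : Finset (Fin (k + 1) × Bool)} :
    s ∈ (crossPolytopeBoundary k).faces ↔ s.Nonempty ∧ ∀ a ∈ s, (a.1, !a.2) ∉ s := by
  refine and_congr_right fun _ => ⟨fun h => ?_, fun h i hi => h _ hi.1 hi.2⟩
  rintro ⟨i, _ | _⟩ ha hb
  · exact h i ⟨hb, ha⟩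
  · exact h i ⟨ha, hb⟩

end CrossPolytope

/-! ### Cross-polytope components of a flag complex -/

section FlagComplex

variable {V : Type*} [Fintype V] [LinearOrder V]

theorem mem_nonNeighbors {G : SimpleGraph V} [DecidableRel G.Adj] {S : Finset V} {u v : V} :
    u ∈ nonNeighbors G S v ↔ u ∈ S ∧ u ≠ v ∧ ¬G.Adj v u := by
  simp only [nonNeighbors, Finset.mem_filter, Finset.mem_erase]
  tauto

/-- Non-adjacency is symmetric, so sending a vertex to its only non-neighbor is an involution. -/
theorem IsAntipodal.exists_involution {G : SimpleGraph V} [DecidableRel G.Adj] {S : Finset V}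
    (hS : IsAntipodal G S) : ∃ g : V → V, ∀ v ∈ S, g v ∈ S ∧ g (g v) = v ∧ g v ≠ v ∧
      ∀ u ∈ S, u ≠ v → (G.Adj v u ↔ u ≠ g v) := by
  choose! g hg using fun v hv => Finset.card_eq_one.1 (hS v hv)
  have key : ∀ v ∈ S, ∀ u, u = g v ↔ u ∈ S ∧ u ≠ v ∧ ¬G.Adj v u := by
    intro v hv u
    rw [← mem_nonNeighbors, hg v hv, Finset.mem_singleton]
  refine ⟨g, fun v hv => ?_⟩
  obtain ⟨h1, h2, h3⟩ := (key v hv (g v)).1 rfl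
  refine ⟨h1, ((key (g v) h1 v).2 ⟨hv, h2.symm, fun h => h3 h.symm⟩).symm, h2, fun u hu huv => ?_⟩
  rw [Ne, key v hv u]
  tauto

variable {K : AbstractSimplicialComplex V}

theorem mem_componentFinset_iff_supp {G : SimpleGraph V} {c : G.ConnectedComponent} {v : V} :
    v ∈ componentFinset c ↔ v ∈ c.supp := by
  rw [mem_componentFinset, SimpleGraph.ConnectedComponent.mem_supp_iff]

/-- Both complexes are flag, so only the graphs matter, and in the graph of the cross-polytope the
sole non-neighbor of a vertex is its antipode. -/
theorem isomorphic_crossPolytopeBoundary_iff [DecidableRel (oneSkeleton K).Adj]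
    (hK : ∀ s, s ∈ K.faces ↔ s.Nonempty ∧ (oneSkeleton K).IsClique s) (k : ℕ)
    (c : (oneSkeleton K).ConnectedComponent) :
    Isomorphic (inducedSubcomplex K c.supp) (crossPolytopeBoundary k) ↔
      IsAntipodal (oneSkeleton K) (componentFinset c) ∧
        (componentFinset c).card = 2 * (k + 1) := by
  classical
  have hcardS : Fintype.card c.supp = (componentFinset c).card := by
    rw [Fintype.card_subtype]
    exact congrArg Finset.card (Finset.ext fun v => by simp [mem_componentFinset])
  constructor
  · rintro ⟨e, he⟩
    refine ⟨fun v hv => ?_, ?_⟩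
    · rw [mem_componentFinset_iff_supp] at hv
      rw [Finset.card_eq_one]
      refine ⟨e.symm ((e ⟨v, hv⟩).1, !(e ⟨v, hv⟩).2), ?_⟩
      ext u
      rw [mem_nonNeighbors, Finset.mem_singleton, mem_componentFinset_iff_supp]
      have key : ∀ hu : u ∈ c.supp, u ≠ v → (¬(oneSkeleton K).Adj v u ↔
          e ⟨u, hu⟩ = ((e ⟨v, hv⟩).1, !(e ⟨v, hv⟩).2)) := by
        intro hu huv
        have h1 := he {⟨v, hv⟩, ⟨u, hu⟩}
        have h2 : ({⟨v, hv⟩, ⟨u, hu⟩} : Finset c.supp) ∈ (inducedSubcomplex K c.supp).faces ↔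
            (oneSkeleton K).Adj v u := by
          change Finset.map _ _ ∈ K.faces ↔ v ≠ u ∧ {v, u} ∈ K.faces
          rw [Finset.map_insert, Finset.map_singleton]
          simp [huv.symm]
        rw [← h2, h1, mem_crossPolytopeBoundary]
        simp only [Finset.map_insert, Finset.map_singleton, Finset.mem_insert,
          Finset.mem_singleton, Equiv.coe_toEmbedding, forall_eq_or_imp, forall_eq, not_and,
          Finset.insert_nonempty, true_and]
        generalize e ⟨v, hv⟩ = a
        generalize e ⟨u, hu⟩ = b
        obtain ⟨i, x⟩ := a
        obtain ⟨j, y⟩ := b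
        rcases x <;> rcases y <;> simp [eq_comm]
      constructor
      · rintro ⟨hu, huv, hadj⟩
        rw [← (key hu huv).1 hadj, Equiv.symm_apply_apply]
      · rintro rfl
        refine ⟨Subtype.coe_prop _, ?_⟩
        have hne : ((e.symm ((e ⟨v, hv⟩).1, !(e ⟨v, hv⟩).2) : c.supp) : V) ≠ v := by
          intro h
          have h1 : e.symm ((e ⟨v, hv⟩).1, !(e ⟨v, hv⟩).2) = ⟨v, hv⟩ := Subtype.ext h
          rw [Equiv.symm_apply_eq] at h1
          have := congr_arg Prod.snd h1
          simp at this
        exact ⟨hne, (key (Subtype.coe_prop _) hne).2 (by simp)⟩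
    · rw [← hcardS, Fintype.card_congr e]
      simp [mul_comm]
  · rintro ⟨hA, hcard⟩
    obtain ⟨g, hg⟩ := hA.exists_involution
    simp only [mem_componentFinset_iff_supp] at hg
    obtain ⟨e, he⟩ := exists_equiv_antipode (m := k + 1)
      (fun v : c.supp => (⟨g v, (hg v v.2).1⟩ : c.supp))
      (fun v => Subtype.ext (hg v v.2).2.1)
      (fun v h => (hg v v.2).2.2.1 (congr_arg Subtype.val h)) (hcardS.trans hcard)
    refine ⟨e, fun s => ?_⟩
    rw [mem_crossPolytopeBoundary]
    change Finset.map _ _ ∈ K.faces ↔ _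
    rw [hK, Finset.map_nonempty, Finset.map_nonempty]
    refine and_congr_right fun _ => ?_
    constructor
    · intro hcl a ha hb
      obtain ⟨v, hv, rfl⟩ := Finset.mem_map.1 ha
      rw [Equiv.coe_toEmbedding, ← he v, ← Equiv.coe_toEmbedding e, Finset.mem_map'] at hb
      obtain ⟨h1, h2, h3, h4⟩ := hg v v.2
      refine (h4 _ h1 h3).1 (hcl ?_ ?_ h3.symm) rfl
      · simpa using ⟨v.2, hv⟩
      · simpa using ⟨h1, hb⟩
    · intro h a ha b hb hab
      simp only [Finset.coe_map, Set.mem_image, Finset.mem_coe] at ha hb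
      obtain ⟨a, ha, rfl⟩ := ha
      obtain ⟨b, hb, rfl⟩ := hb
      refine ((hg a a.2).2.2.2 b b.2 hab.symm).2 fun hba => ?_
      refine h (e a) (Finset.mem_map_of_mem _ ha) ?_
      rw [← he a, ← Equiv.coe_toEmbedding e, Finset.mem_map']
      convert hb
      exact hba.symm

theorem crossPolytopeComponents_eq [DecidableRel (oneSkeleton K).Adj]
    (hK : ∀ s, s ∈ K.faces ↔ s.Nonempty ∧ (oneSkeleton K).IsClique s) (k : ℕ) :
    crossPolytopeComponents K k = Nat.card (AntipodalComponent (oneSkeleton K) k) :=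
  Nat.card_congr (Equiv.subtypeEquivRight fun c => isomorphic_crossPolytopeBoundary_iff hK k c)

end FlagComplex

/-! ### Clusters of `2 * k + 3` nearby points control all errors -/

section Counting

variable {V : Type*} [Fintype V] [LinearOrder V] {G : SimpleGraph V}
  {E : Type*} [PseudoMetricSpace E]

open Classical in
/-- The sets of `m` indices whose points lie pairwise within distance `ρ`. -/
noncomputable def nearSets (x : V → E) (m : ℕ) (ρ : ℝ) : Finset (Finset V) :=
  Finset.univ.filter fun T => T.card = m ∧ ∀ i ∈ T, ∀ j ∈ T, dist (x i) (x j) ≤ ρ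

/-- A nonempty part of a component that is not the whole component has a neighbor in it. -/
theorem exists_adj_of_subset_component {c : G.ConnectedComponent} {T : Finset V}
    (hT : T.Nonempty) (hTc : T ⊂ componentFinset c) :
    ∃ u ∈ T, ∃ v ∈ componentFinset c, v ∉ T ∧ G.Adj u v := by
  obtain ⟨a, ha⟩ := hT
  obtain ⟨b, hb, hbT⟩ := Finset.exists_of_ssubset hTc
  have hab : G.Reachable a b := by
    rw [← SimpleGraph.ConnectedComponent.eq, mem_componentFinset.1 (hTc.subset ha),
      mem_componentFinset.1 hb]
  obtain ⟨p⟩ := hab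
  obtain ⟨e, -, h1, h2⟩ := p.exists_boundary_dart (T : Set V) ha hbT
  refine ⟨e.fst, h1, e.snd, ?_, h2, e.adj⟩
  rw [mem_componentFinset, ← mem_componentFinset.1 (hTc.subset h1),
    SimpleGraph.ConnectedComponent.eq]
  exact e.adj.symm.reachable

/-- The set grows inside its component by one adjacent vertex at a time, and each addition raises
the diameter bound by `r`. -/
theorem exists_near_superset {x : V → E} {r : ℝ} (hr : 0 ≤ r)
    (hG : ∀ i j, G.Adj i j → dist (x i) (x j) ≤ r) {c : G.ConnectedComponent} {s : Finset V}
    (hs : s.Nonempty) (hsc : s ⊆ componentFinset c)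
    (hsd : ∀ i ∈ s, ∀ j ∈ s, dist (x i) (x j) ≤ s.card * r) {m : ℕ} (hm : s.card ≤ m)
    (hmc : m ≤ (componentFinset c).card) :
    ∃ T ∈ nearSets x m (m * r), s ⊆ T := by
  suffices h : ∃ T, s ⊆ T ∧ T ⊆ componentFinset c ∧ T.card = m ∧
      ∀ i ∈ T, ∀ j ∈ T, dist (x i) (x j) ≤ m * r by
    obtain ⟨T, h1, -, h2⟩ := h
    exact ⟨T, by simpa [nearSets] using h2, h1⟩
  induction m, hm using Nat.le_induction with
  | base => exact ⟨s, subset_rfl, hsc, rfl, hsd⟩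
  | succ m hm ih =>
    obtain ⟨T, hsT, hTc, hcard, hd⟩ := ih (by omega)
    have hss : T ⊂ componentFinset c := by
      refine hTc.ssubset_of_ne fun h => ?_
      rw [h] at hcard
      omega
    obtain ⟨u, hu, v, hvc, hvT, huv⟩ := exists_adj_of_subset_component (hs.mono hsT) hss
    have huv' := hG u v huv
    have hle : (m : ℝ) * r ≤ (m + 1 : ℕ) * r := by push_cast; nlinarith
    have hv : ∀ i ∈ T, dist (x i) (x v) ≤ (m + 1 : ℕ) * r := by
      intro i hi
      have h1 := dist_triangle (x i) (x u) (x v)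
      have h2 := hd i hi u hu
      push_cast
      linarith
    refine ⟨insert v T, hsT.trans (Finset.subset_insert v T), Finset.insert_subset hvc hTc,
      by rw [Finset.card_insert_of_notMem hvT, hcard], ?_⟩
    intro i hi j hj
    rcases Finset.mem_insert.1 hi with rfl | hi' <;>
      rcases Finset.mem_insert.1 hj with rfl | hj'
    · rw [dist_self]; positivity
    · rw [dist_comm]; exact hv j hj'
    · exact hv i hi'
    · exact (hd i hi' j hj').trans hle

/-- Each member of `D` has only `2 ^ m` subsets; this is the source of the factor `2 ^ (2 * k + 3)`
in the error terms. -/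
theorem card_le_of_forall_exists_superset {A D : Finset (Finset V)} {m : ℕ}
    (hD : ∀ T ∈ D, T.card = m) (hA : ∀ s ∈ A, ∃ T ∈ D, s ⊆ T) : A.card ≤ D.card * 2 ^ m := by
  have hsub : A ⊆ D.biUnion Finset.powerset := fun s hs => by
    obtain ⟨T, hT, hsT⟩ := hA s hs
    exact Finset.mem_biUnion.2 ⟨T, hT, Finset.mem_powerset.2 hsT⟩
  refine (Finset.card_le_card hsub).trans (Finset.card_biUnion_le_card_mul _ _ _ fun T hT => ?_)
  rw [Finset.card_powerset, hD T hT]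

theorem card_eq_of_mem_nearSets {x : V → E} {m : ℕ} {ρ : ℝ} {T : Finset V}
    (hT : T ∈ nearSets x m ρ) : T.card = m := by
  simp only [nearSets, Finset.mem_filter] at hT
  exact hT.2.1

theorem card_facesInLargeComponents_le {x : V → E} {r : ℝ} (hr : 0 ≤ r)
    (hG : ∀ i j, G.Adj i j → dist (x i) (x j) ≤ r) (k : ℕ) :
    (facesInLargeComponents G k).card
      ≤ (nearSets x (2 * k + 3) ((2 * k + 3 : ℕ) * r)).card * 2 ^ (2 * k + 3) := by
  refine card_le_of_forall_exists_superset (fun T => card_eq_of_mem_nearSets) fun s hs => ?_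
  simp only [facesInLargeComponents, Finset.mem_filter, Finset.mem_univ, true_and] at hs
  obtain ⟨hcl, hcard, v, hv, hc⟩ := hs
  refine exists_near_superset hr hG ⟨v, hv⟩ (clique_subset_componentFinset hcl hv) ?_
    (by omega) hc
  intro i hi j hj
  rw [hcard]
  have hle : r ≤ (k + 1 : ℕ) * r := by
    push_cast; nlinarith [mul_nonneg (Nat.cast_nonneg (α := ℝ) k) hr]
  by_cases hij : i = j
  · rw [hij, dist_self]; positivity
  · exact (hG i j (hcl hi hj hij)).trans hle

variable [DecidableRel G.Adj]

variable (G) in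
open Classical in
/-- The vertex sets inducing the graph of a cross-polytope with `2 (k + 1)` vertices. -/
noncomputable def antipodalSets (k : ℕ) : Finset (Finset V) :=
  Finset.univ.filter fun S => IsAntipodal G S ∧ S.card = 2 * (k + 1)

theorem card_antipodalComponent_le (k : ℕ) :
    Nat.card (AntipodalComponent G k) ≤ (antipodalSets G k).card := by
  rw [← Fintype.card_coe, ← Nat.card_eq_fintype_card]
  refine Nat.card_le_card_of_injective
    (fun c => ⟨componentFinset c.1, by simpa [antipodalSets] using c.2⟩) fun c c' h => ?_
  have h : componentFinset c.1 = componentFinset c'.1 := congr_arg Subtype.val h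
  obtain ⟨v, hv⟩ : (componentFinset c.1).Nonempty := by
    rw [← Finset.card_pos, c.2.2]; omega
  have h1 := mem_componentFinset.1 hv
  rw [h] at hv
  exact Subtype.ext (h1.symm.trans (mem_componentFinset.1 hv))

/-- An antipodal set with more than two vertices is connected with graph diameter at most two. It is
therefore a whole component, counted by the first term, or a proper part of one, and then it grows
to a cluster. -/
theorem card_antipodalSets_le {x : V → E} {r : ℝ} (hr : 0 ≤ r)
    (hG : ∀ i j, G.Adj i j → dist (x i) (x j) ≤ r) {k : ℕ} (hk : 1 ≤ k) :
    (antipodalSets G k).card ≤ Nat.card (AntipodalComponent G k)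
      + (nearSets x (2 * k + 3) ((2 * k + 3 : ℕ) * r)).card * 2 ^ (2 * k + 3) := by
  classical
  have hsplit := Finset.card_filter_add_card_filter_not (s := antipodalSets G k)
    (fun S => ∃ c : G.ConnectedComponent, S = componentFinset c)
  rw [← hsplit]
  refine add_le_add ?_ (card_le_of_forall_exists_superset (fun T => card_eq_of_mem_nearSets) ?_)
  · rw [Nat.card_eq_fintype_card, ← Finset.card_univ,
      ← Finset.card_image_of_injOn (f := fun c : AntipodalComponent G k => componentFinset c.1)
        (s := Finset.univ)]
    · refine Finset.card_le_card fun S hS => ?_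
      obtain ⟨hS, c, rfl⟩ := Finset.mem_filter.1 hS
      simp only [antipodalSets, Finset.mem_filter, Finset.mem_univ, true_and] at hS
      exact Finset.mem_image.2 ⟨⟨c, hS⟩, Finset.mem_univ _, rfl⟩
    · intro c _ c' _ h
      have h : componentFinset c.1 = componentFinset c'.1 := h
      obtain ⟨v, hv⟩ : (componentFinset c.1).Nonempty := by
        rw [← Finset.card_pos, c.2.2]; omega
      have h1 := mem_componentFinset.1 hv
      rw [h] at hv
      exact Subtype.ext (h1.symm.trans (mem_componentFinset.1 hv))
  · intro S hS
    obtain ⟨hS, hnc⟩ := Finset.mem_filter.1 hS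
    simp only [antipodalSets, Finset.mem_filter, Finset.mem_univ, true_and] at hS
    obtain ⟨hA, hcard⟩ := hS
    obtain ⟨g, hg⟩ := hA.exists_involution
    have hpath : ∀ i ∈ S, ∀ j ∈ S, i ≠ j → ¬G.Adj i j → ∃ w, G.Adj i w ∧ G.Adj w j := by
      intro i hi j hj hij hadj
      have hj' : j = g i := by
        by_contra hn
        exact hadj (((hg i hi).2.2.2 j hj hij.symm).2 hn)
      -- Here `1 ≤ k` matters: a third vertex exists, and it is adjacent to both members of an
      -- antipodal pair.
      have hlt : ({i, j} : Finset V).card < S.card := by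
        have := Finset.card_le_two (a := i) (b := j)
        omega
      obtain ⟨w, hw, hwn⟩ := Finset.exists_mem_notMem_of_card_lt_card hlt
      simp only [Finset.mem_insert, Finset.mem_singleton, not_or] at hwn
      refine ⟨w, ((hg i hi).2.2.2 w hw hwn.1).2 (hj' ▸ hwn.2), ?_⟩
      refine (((hg j hj).2.2.2 w hw hwn.2).2 ?_).symm
      rw [hj', (hg i hi).2.1]
      exact hwn.1
    obtain ⟨v, hv⟩ : S.Nonempty := by rw [← Finset.card_pos]; omega
    have hsub : S ⊆ componentFinset (G.connectedComponentMk v) := by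
      intro u hu
      rw [mem_componentFinset, SimpleGraph.ConnectedComponent.eq]
      by_cases huv : u = v
      · rw [huv]
      by_cases hadj : G.Adj u v
      · exact hadj.reachable
      obtain ⟨w, h1, h2⟩ := hpath u hu v hv huv hadj
      exact h1.reachable.trans h2.reachable
    have hlt := Finset.card_lt_card (hsub.ssubset_of_ne fun h => hnc ⟨_, h⟩)
    refine exists_near_superset hr hG ⟨v, hv⟩ hsub ?_ (by omega) (by omega)
    intro i hi j hj
    have h2 : 2 * r ≤ S.card * r := by
      refine mul_le_mul_of_nonneg_right ?_ hr
      rw [hcard]; push_cast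
      nlinarith [Nat.cast_nonneg (α := ℝ) k]
    by_cases hij : i = j
    · rw [hij, dist_self]; positivity
    by_cases hadj : G.Adj i j
    · exact (hG i j hadj).trans (by linarith)
    obtain ⟨w, h3, h4⟩ := hpath i hi j hj hij hadj
    linarith [dist_triangle (x i) (x w) (x j), hG i w h3, hG w j h4]

end Counting

/-! ### The Rips complex as the flag complex of a proximity graph -/

section Rips

variable {ι E : Type*} [LinearOrder ι] [NormedAddCommGroup E] [NormedSpace ℝ E]

theorem closedBall_inter_closedBall_half_nonempty {x y : E} {r : ℝ} :
    (Metric.closedBall x (r / 2) ∩ Metric.closedBall y (r / 2)).Nonempty ↔ dist x y ≤ r := by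
  constructor
  · rintro ⟨z, hx, hy⟩
    rw [Metric.mem_closedBall] at hx hy
    linarith [dist_triangle_left x y z]
  · intro h
    refine ⟨midpoint ℝ x y, ?_, ?_⟩ <;>
      simp only [Metric.mem_closedBall, dist_midpoint_left, dist_midpoint_right] <;>
      norm_num <;> linarith

theorem oneSkeleton_ripsComplex_adj {x : ι → E} {r : ℝ} {i j : ι} :
    (oneSkeleton (ripsComplex x r)).Adj i j ↔ i ≠ j ∧ dist (x i) (x j) ≤ r := by
  refine and_congr_right fun hij => ?_
  rw [← closedBall_inter_closedBall_half_nonempty]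
  refine ⟨fun h => h.2 (by simp) (by simp) hij, fun h => ⟨by simp, ?_⟩⟩
  rw [Finset.coe_pair, Set.pairwise_pair]
  exact fun _ => ⟨h, by rwa [Set.inter_comm]⟩

theorem mem_ripsComplex_faces {x : ι → E} {r : ℝ} (s : Finset ι) :
    s ∈ (ripsComplex x r).faces ↔ s.Nonempty ∧ (oneSkeleton (ripsComplex x r)).IsClique s := by
  refine and_congr_right fun _ => forall₂_congr fun i _ => forall₂_congr fun j _ => ?_
  refine forall_congr' fun hij => ?_
  rw [oneSkeleton_ripsComplex_adj]
  exact closedBall_inter_closedBall_half_nonempty.trans (by simp [hij])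

end Rips

/-! ### Small-scale probabilities for points with a bounded density -/

open scoped ENNReal

/-- Densities on a finite power multiply. -/
theorem pi_withDensity_ofReal {ι E : Type*} [Fintype ι] [MeasurableSpace E] {ν : Measure E}
    [SigmaFinite ν] {f : E → ℝ} (hf0 : ∀ x, 0 ≤ f x) (hfi : Integrable f ν) :
    Measure.pi (fun _ : ι => ν.withDensity fun x => ENNReal.ofReal (f x))
      = (Measure.pi fun _ : ι => ν).withDensity fun x => ∏ i, ENNReal.ofReal (f (x i)) := by
  have : IsFiniteMeasure (ν.withDensity fun x => ENNReal.ofReal (f x)) :=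
    isFiniteMeasure_withDensity_ofReal hfi.2
  refine Measure.pi_eq fun s hs => ?_
  rw [withDensity_apply _ (MeasurableSet.univ_pi hs), Measure.restrict_pi_pi]
  -- The box integral is rewritten as a Bochner integral of a real product, which factors over the
  -- coordinates.
  simp_rw [← ENNReal.ofReal_prod_of_nonneg fun i _ => hf0 _]
  rw [← ofReal_integral_eq_lintegral_ofReal
    (Integrable.fintype_prod fun i => hfi.restrict)
    (Eventually.of_forall fun x => Finset.prod_nonneg fun i _ => hf0 _),
    integral_fintype_prod_eq_prod (fun _ => f),
    ENNReal.ofReal_prod_of_nonneg fun i _ => integral_nonneg hf0]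
  refine Finset.prod_congr rfl fun i _ => ?_
  rw [withDensity_apply _ (hs i), ofReal_integral_eq_lintegral_ofReal hfi.restrict
    (Eventually.of_forall hf0)]

theorem prod_le_pow_card_of_nonneg {ι : Type*} (s : Finset ι) {a : ι → ℝ} {M : ℝ}
    (ha0 : ∀ i, 0 ≤ a i) (ha : ∀ i, a i ≤ M) : ∏ i ∈ s, a i ≤ M ^ s.card := by
  rw [← Finset.prod_const]
  exact Finset.prod_le_prod (fun i _ => ha0 i) fun i _ => ha i

/-- Factors are exchanged one at a time; `1 ≤ M` lets the same power of `M` bound every remaining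
product. -/
theorem abs_prod_sub_prod_le {ι : Type*} (s : Finset ι) {a b : ι → ℝ} {M : ℝ} (hM : 1 ≤ M)
    (ha : ∀ i, |a i| ≤ M) (hb : ∀ i, |b i| ≤ M) :
    |∏ i ∈ s, a i - ∏ i ∈ s, b i| ≤ M ^ s.card * ∑ i ∈ s, |a i - b i| := by
  classical
  have h0 : 0 ≤ M := by linarith
  induction s using Finset.induction_on with
  | empty => simp
  | insert i s hi ih =>
    rw [Finset.prod_insert hi, Finset.prod_insert hi, Finset.sum_insert hi,
      Finset.card_insert_of_notMem hi]
    have h1 : |∏ j ∈ s, a j| ≤ M ^ s.card := by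
      rw [Finset.abs_prod]
      exact prod_le_pow_card_of_nonneg s (fun _ => abs_nonneg _) ha
    have h2 : M ^ s.card ≤ M ^ (s.card + 1) := pow_le_pow_right₀ hM (Nat.le_succ _)
    calc |a i * ∏ j ∈ s, a j - b i * ∏ j ∈ s, b j|
        = |(a i - b i) * ∏ j ∈ s, a j + b i * (∏ j ∈ s, a j - ∏ j ∈ s, b j)| := by ring_nf
      _ ≤ |a i - b i| * |∏ j ∈ s, a j| + |b i| * |∏ j ∈ s, a j - ∏ j ∈ s, b j| := by
          rw [← abs_mul, ← abs_mul]; exact abs_add_le _ _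
      _ ≤ |a i - b i| * M ^ (s.card + 1) + M * (M ^ s.card * ∑ j ∈ s, |a j - b j|) := by
          gcongr
          · exact h1.trans h2
          · exact hb i
      _ = M ^ (s.card + 1) * (|a i - b i| + ∑ j ∈ s, |a j - b j|) := by ring

variable {E : Type*} [NormedAddCommGroup E] [NormedSpace ℝ E] [FiniteDimensional ℝ E]
  [MeasurableSpace E] [BorelSpace E] {ν : Measure E} [ν.IsAddHaarMeasure]

/-- Translation is continuous in `L¹`. -/
theorem tendsto_integral_abs_translate_sub {f : E → ℝ} (hf : Integrable f ν) :
    Tendsto (fun h : E => ∫ x, |f (x + h) - f x| ∂ν) (𝓝 0) (𝓝 0) := by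
  have hf1 : MemLp f 1 ν := memLp_one_iff_integrable.2 hf
  let g : E → C(E, E) := fun h => ⟨fun x => x + h, by fun_prop⟩
  have hg : ∀ h, MeasurePreserving (g h) ν ν := fun h => measurePreserving_add_right ν h
  have hgc : Tendsto g (𝓝 0) (𝓝 (g 0)) := by
    have : Continuous g := ContinuousMap.continuous_of_continuous_uncurry _ (by
      change Continuous fun p : E × E => p.2 + p.1
      fun_prop)
    exact this.tendsto 0
  have key := (tendsto_const_nhds (x := hf1.toLp f)).compMeasurePreservingLp hgc hg (hg 0)
    ENNReal.one_ne_top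
  rw [tendsto_iff_norm_sub_tendsto_zero] at key
  refine key.congr fun h => ?_
  rw [Lp.toLp_compMeasurePreserving hf1 (hg h), Lp.toLp_compMeasurePreserving hf1 (hg 0),
    ← MemLp.toLp_sub, L1.norm_eq_integral_norm]
  refine integral_congr_ae ?_
  filter_upwards [MemLp.coeFn_toLp ((hf1.comp_measurePreserving (hg h)).sub
    (hf1.comp_measurePreserving (hg 0)))] with x hx
  rw [hx]
  simp [g, Real.norm_eq_abs]

theorem integrable_mul_prod_translate {f : E → ℝ} {M : ℝ} (hf : Measurable f)
    (hf0 : ∀ x, 0 ≤ f x) (hfM : ∀ x, f x ≤ M) (hfi : Integrable f ν) {m : ℕ} (h : Fin m → E) :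
    Integrable (fun x => f x * ∏ i, f (x + h i)) ν := by
  refine hfi.mul_bdd (c := M ^ m) ?_ ?_
  · exact (Finset.measurable_fun_prod _ fun i _ =>
      hf.comp (measurable_id.add_const _)).aestronglyMeasurable
  · refine Eventually.of_forall fun x => ?_
    rw [Real.norm_eq_abs, Finset.abs_prod]
    refine (prod_le_pow_card_of_nonneg (M := M) _ (fun _ => abs_nonneg _) fun i => ?_).trans
      (by simp)
    rw [abs_of_nonneg (hf0 _)]
    exact hfM _

/-- Boundedness reduces the product to a sum of `L¹` distances between `f` and its translates, so no
continuity of `f` is needed. -/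
theorem tendsto_integral_mul_prod_translate {f : E → ℝ} {M : ℝ} (hf : Measurable f)
    (hf0 : ∀ x, 0 ≤ f x) (hfM : ∀ x, f x ≤ M) (hfi : Integrable f ν) {m : ℕ} (y : Fin m → E) :
    Tendsto (fun r : ℝ => ∫ x, f x * ∏ i, f (x + r • y i) ∂ν) (𝓝 0)
      (𝓝 (∫ x, f x ^ (m + 1) ∂ν)) := by
  wlog hM : 1 ≤ M generalizing M
  · exact this (fun x => (hfM x).trans (le_of_not_ge hM)) le_rfl
  have hint : ∀ r : ℝ, Integrable (fun x => f x * ∏ i, f (x + r • y i)) ν := fun r =>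
    integrable_mul_prod_translate hf hf0 hfM hfi fun i => r • y i
  have hint0 : Integrable (fun x => f x ^ (m + 1)) ν := by
    convert hint 0 using 2 with x
    simp [pow_succ']
  have habs : ∀ x, |f x| ≤ M := fun x => by rw [abs_of_nonneg (hf0 x)]; exact hfM x
  have htr : ∀ h : E, Integrable (fun x => |f (x + h) - f x|) ν := fun h =>
    ((hfi.comp_add_right h).sub hfi).abs
  rw [tendsto_iff_norm_sub_tendsto_zero]
  refine squeeze_zero (g := fun r => M ^ (m + 1) * ∑ i, ∫ x, |f (x + r • y i) - f x| ∂ν)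
    (fun _ => norm_nonneg _) (fun r => ?_) ?_
  · rw [← integral_sub (hint r) hint0, ← integral_finsetSum _ fun i _ => htr _,
      ← integral_const_mul]
    refine norm_integral_le_of_norm_le
      ((integrable_finsetSum _ fun i _ => htr _).const_mul _) (Eventually.of_forall fun x => ?_)
    have h1 := abs_prod_sub_prod_le Finset.univ hM (fun i => habs (x + r • y i))
      (fun _ : Fin m => habs x)
    rw [Finset.prod_const, Finset.card_fin] at h1
    rw [pow_succ', ← mul_sub, Real.norm_eq_abs, abs_mul, pow_succ' M, mul_assoc]
    exact mul_le_mul (habs x) h1 (abs_nonneg _) (by linarith)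
  · have h0 : ∀ i, Tendsto (fun r : ℝ => ∫ x, |f (x + r • y i) - f x| ∂ν) (𝓝 0) (𝓝 0) := by
      intro i
      refine (tendsto_integral_abs_translate_sub hfi).comp ?_
      have : Continuous fun r : ℝ => r • y i := by fun_prop
      simpa using this.tendsto 0
    simpa using (tendsto_finsetSum Finset.univ fun i _ => h0 i).const_mul (M ^ (m + 1))

theorem piFinSuccAbove_symm_preimage {m : ℕ} (A : Set (Fin (m + 1) → E)) (x : E) :
    Prod.mk x ⁻¹' ((MeasurableEquiv.piFinSuccAbove (fun _ : Fin (m + 1) => E) 0).symm ⁻¹' A)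
      = {y | (Fin.cons x y : Fin (m + 1) → E) ∈ A} := by
  ext y
  simp only [Set.mem_preimage, MeasurableEquiv.piFinSuccAbove_symm_apply, Set.mem_ofPred_eq]
  rw [Fin.insertNthEquiv_zero]
  rfl

theorem pi_succ_apply {μ : Measure E} [SigmaFinite μ] {m : ℕ} {A : Set (Fin (m + 1) → E)}
    (hA : MeasurableSet A) :
    Measure.pi (fun _ : Fin (m + 1) => μ) A
      = ∫⁻ x, Measure.pi (fun _ : Fin m => μ) {y | (Fin.cons x y : Fin (m + 1) → E) ∈ A} ∂μ := by
  have h := (measurePreserving_piFinSuccAbove (fun _ : Fin (m + 1) => μ) 0).symm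
  rw [← h.measure_preimage hA.nullMeasurableSet,
    Measure.prod_apply ((MeasurableEquiv.measurable _) hA)]
  exact lintegral_congr fun x => congrArg _ (piFinSuccAbove_symm_preimage A x)

theorem lintegral_comp_add_smul {m : ℕ} {g : (Fin m → E) → ℝ≥0∞} (hg : Measurable g) (x : E)
    {r : ℝ} (hr : 0 < r) :
    ∫⁻ y, g y ∂(Measure.pi fun _ : Fin m => ν)
      = ENNReal.ofReal (r ^ (m * Module.finrank ℝ E))
        * ∫⁻ y, g (fun i => x + r • y i) ∂(Measure.pi fun _ : Fin m => ν) := by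
  rw [← lintegral_add_left_eq_self g fun _ => x]
  have h := Measure.map_addHaar_smul (Measure.pi fun _ : Fin m => ν) hr.ne'
  have hg' : Measurable fun y => g ((fun _ => x) + y) := hg.comp (measurable_const_add _)
  have h2 : ∫⁻ y, g (fun i => x + r • y i) ∂(Measure.pi fun _ : Fin m => ν)
      = ∫⁻ y, g ((fun _ => x) + y) ∂((Measure.pi fun _ : Fin m => ν).map (r • ·)) := by
    rw [lintegral_map hg' (measurable_const_smul r)]
    rfl
  rw [h2, h, lintegral_smul_measure, smul_eq_mul, ← mul_assoc, Module.finrank_pi_fintype,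
    Finset.sum_const, Finset.card_fin, smul_eq_mul, ← ENNReal.ofReal_mul (by positivity),
    abs_of_nonneg (by positivity), mul_inv_cancel₀ (by positivity), ENNReal.ofReal_one, one_mul]

/-- A translation-invariant event about `m + 1` independent points with a bounded density,
scaled down by `r`, has probability asymptotic to a constant times `r ^ (m * dim)`. -/
theorem tendsto_pi_withDensity_div {f : E → ℝ} {M : ℝ} (hf : Measurable f)
    (hf0 : ∀ x, 0 ≤ f x) (hfM : ∀ x, f x ≤ M) (hfi : Integrable f ν) {m : ℕ}
    {T : Set (Fin m → E)} (hT : MeasurableSet T) (hTfin : Measure.pi (fun _ : Fin m => ν) T ≠ ∞)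
    {A : ℝ → Set (Fin (m + 1) → E)} (hA : ∀ r, MeasurableSet (A r))
    (hAT : ∀ r > 0, ∀ (x : E) (y : Fin m → E),
      (Fin.cons x (fun i => x + r • y i) : Fin (m + 1) → E) ∈ A r ↔ y ∈ T) :
    Tendsto (fun r : ℝ =>
        (Measure.pi (fun _ : Fin (m + 1) => ν.withDensity fun x => ENNReal.ofReal (f x)) (A r)).toReal
          / r ^ (m * Module.finrank ℝ E)) (𝓝[>] 0)
      (𝓝 ((∫ x, f x ^ (m + 1) ∂ν) * (Measure.pi (fun _ : Fin m => ν) T).toReal)) := by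
  classical
  set D := m * Module.finrank ℝ E
  have : IsFiniteMeasure (ν.withDensity fun x => ENNReal.ofReal (f x)) :=
    isFiniteMeasure_withDensity_ofReal hfi.2
  have hM : 0 ≤ M := (hf0 0).trans (hfM 0)
  have hfE : Measurable fun x => ENNReal.ofReal (f x) := hf.ennreal_ofReal
  have hprodE : Measurable fun y : Fin m → E => ∏ i, ENNReal.ofReal (f (y i)) :=
    Finset.measurable_fun_prod _ fun i _ => hfE.comp (measurable_pi_apply i)
  -- Conditioning on the first point `x` and substituting `x + r • y` for the others turns the event
  -- into `y ∈ T`, free of `x` and `r`. Tonelli then puts the integral over `x` inside.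
  have key : ∀ r > 0,
      Measure.pi (fun _ : Fin (m + 1) => ν.withDensity fun x => ENNReal.ofReal (f x)) (A r)
      = ENNReal.ofReal (r ^ D) * ∫⁻ y in T, ENNReal.ofReal (∫ x, f x * ∏ i, f (x + r • y i) ∂ν)
          ∂(Measure.pi fun _ : Fin m => ν) := by
    intro r hr
    have hAx : ∀ x, MeasurableSet {y : Fin m → E | (Fin.cons x y : Fin (m + 1) → E) ∈ A r} :=
      fun x => (hA r).preimage (by
        refine measurable_pi_iff.2 (Fin.forall_fin_succ.2 ⟨?_, fun i => ?_⟩)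
        · simp
        · simpa using measurable_pi_apply i)
    have hmeas : Measurable fun p : E × (Fin m → E) =>
        ENNReal.ofReal (f p.1) * ∏ i, ENNReal.ofReal (f (p.1 + r • p.2 i)) := by
      refine (hfE.comp measurable_fst).mul (Finset.measurable_fun_prod _ fun i _ => hfE.comp ?_)
      exact measurable_fst.add (((measurable_pi_apply i).comp measurable_snd).const_smul r)
    calc _ = ∫⁻ x, ENNReal.ofReal (f x) * (ENNReal.ofReal (r ^ D) *
          ∫⁻ y in T, ∏ i, ENNReal.ofReal (f (x + r • y i)) ∂(Measure.pi fun _ : Fin m => ν)) ∂ν := by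
            rw [pi_succ_apply (hA r), pi_withDensity_ofReal hf0 hfi,
              lintegral_withDensity_eq_lintegral_mul₀' hfE.aemeasurable]
            · refine lintegral_congr fun x => ?_
              rw [Pi.mul_apply, withDensity_apply _ (hAx x), ← lintegral_indicator (hAx x),
                lintegral_comp_add_smul (hprodE.indicator (hAx x)) x hr, ← lintegral_indicator hT]
              congr 2
              refine lintegral_congr fun y => ?_
              simp only [Set.indicator, Set.mem_ofPred_eq, hAT r hr]
            · have := measurable_measure_prodMk_left (ν := (Measure.pi fun _ : Fin m => ν).withDensity
                fun y => ∏ i, ENNReal.ofReal (f (y i))) (s := (MeasurableEquiv.piFinSuccAbove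
                  (fun _ : Fin (m + 1) => E) 0).symm ⁻¹' A r)
                  ((MeasurableEquiv.measurable _) (hA r))
              simp only [piFinSuccAbove_symm_preimage] at this
              exact this.aemeasurable
      _ = ENNReal.ofReal (r ^ D) * ∫⁻ x, ∫⁻ y in T,
          ENNReal.ofReal (f x) * ∏ i, ENNReal.ofReal (f (x + r • y i))
            ∂(Measure.pi fun _ : Fin m => ν) ∂ν := by
            rw [← lintegral_const_mul' _ _ ENNReal.ofReal_ne_top]
            refine lintegral_congr fun x => ?_
            rw [lintegral_const_mul' _ _ ENNReal.ofReal_ne_top]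
            ring
      _ = _ := by
            rw [lintegral_lintegral_swap hmeas.aemeasurable]
            congr 1
            refine lintegral_congr fun y => ?_
            rw [ofReal_integral_eq_lintegral_ofReal
              (integrable_mul_prod_translate hf hf0 hfM hfi fun i => r • y i)
              (Eventually.of_forall fun x =>
                mul_nonneg (hf0 _) (Finset.prod_nonneg fun i _ => hf0 _))]
            refine lintegral_congr fun x => ?_
            rw [ENNReal.ofReal_mul (hf0 _), ENNReal.ofReal_prod_of_nonneg fun i _ => hf0 _]
  have hlim : Tendsto (fun r : ℝ => ∫⁻ y in T,
        ENNReal.ofReal (∫ x, f x * ∏ i, f (x + r • y i) ∂ν) ∂(Measure.pi fun _ : Fin m => ν))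
      (𝓝[>] 0) (𝓝 (ENNReal.ofReal (∫ x, f x ^ (m + 1) ∂ν) *
        Measure.pi (fun _ : Fin m => ν) T)) := by
    rw [← setLIntegral_const]
    -- The inner integral is at most `M ^ m` times the integral of `f`, which is integrable over `T`
    -- since `T` has finite measure.
    refine tendsto_lintegral_filter_of_dominated_convergence
      (fun _ => ENNReal.ofReal ((∫ x, f x ∂ν) * M ^ m)) ?_ ?_ ?_ ?_
    · refine Eventually.of_forall fun r => ?_
      have hmeas : StronglyMeasurable fun p : (Fin m → E) × E =>
          f p.2 * ∏ i, f (p.2 + r • p.1 i) := by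
        refine Measurable.stronglyMeasurable ?_
        refine (hf.comp measurable_snd).mul (Finset.measurable_fun_prod _ fun i _ => hf.comp ?_)
        exact measurable_snd.add (((measurable_pi_apply i).comp measurable_fst).const_smul r)
      exact hmeas.integral_prod_right.measurable.ennreal_ofReal
    · refine Eventually.of_forall fun r => Eventually.of_forall fun y =>
        ENNReal.ofReal_le_ofReal ?_
      rw [← integral_mul_const]
      refine integral_mono (integrable_mul_prod_translate hf hf0 hfM hfi fun i => r • y i)
        (hfi.mul_const _) fun x => mul_le_mul_of_nonneg_left ?_ (hf0 x)
      exact (prod_le_pow_card_of_nonneg _ (fun i => hf0 _) fun i => hfM _).trans (by simp)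
    · rw [setLIntegral_const]
      exact ENNReal.mul_ne_top ENNReal.ofReal_ne_top hTfin
    · exact Eventually.of_forall fun y => ENNReal.tendsto_ofReal
        ((tendsto_integral_mul_prod_translate hf hf0 hfM hfi y).mono_left nhdsWithin_le_nhds)
  have hreal := (ENNReal.tendsto_toReal
    (ENNReal.mul_ne_top ENNReal.ofReal_ne_top hTfin)).comp hlim
  rw [ENNReal.toReal_mul, ENNReal.toReal_ofReal (integral_nonneg fun x => pow_nonneg (hf0 x) _)]
    at hreal
  refine hreal.congr' ?_
  filter_upwards [self_mem_nhdsWithin] with r hr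
  rw [Set.mem_Ioi] at hr
  rw [key r hr, ENNReal.toReal_mul, ENNReal.toReal_ofReal (by positivity), Function.comp_apply,
    mul_div_cancel_left₀ _ (by positivity)]

/-- The probability that `m + 1` independent points with a bounded density are within distance
`ρ` of each other is `O(ρ ^ (m * dim))`. -/
theorem pi_withDensity_near_le {f : E → ℝ} {M : ℝ} (hfM : ∀ x, f x ≤ M)
    [IsProbabilityMeasure (ν.withDensity fun x => ENNReal.ofReal (f x))] (m : ℕ) {ρ : ℝ}
    (hρ : 0 ≤ ρ) :
    Measure.pi (fun _ : Fin (m + 1) => ν.withDensity fun x => ENNReal.ofReal (f x))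
        {x | ∀ i j, dist (x i) (x j) ≤ ρ}
      ≤ (ENNReal.ofReal M * ν (Metric.ball 0 1)) ^ m
        * ENNReal.ofReal (ρ ^ (m * Module.finrank ℝ E)) := by
  set μ := ν.withDensity fun x => ENNReal.ofReal (f x)
  have hball : ∀ x, μ (Metric.closedBall x ρ)
      ≤ ENNReal.ofReal M * ν (Metric.ball 0 1) * ENNReal.ofReal (ρ ^ Module.finrank ℝ E) := by
    intro x
    rw [withDensity_apply _ Metric.isClosed_closedBall.measurableSet]
    calc _ ≤ ∫⁻ _ in Metric.closedBall x ρ, ENNReal.ofReal M ∂ν :=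
          lintegral_mono fun y => ENNReal.ofReal_le_ofReal (hfM y)
      _ = _ := by rw [setLIntegral_const, Measure.addHaar_closedBall _ _ hρ]; ring
  have hclosed : IsClosed {x : Fin (m + 1) → E | ∀ i j, dist (x i) (x j) ≤ ρ} := by
    simp only [Set.ofPred_forall]
    exact isClosed_iInter fun i => isClosed_iInter fun j =>
      isClosed_le (by fun_prop) continuous_const
  rw [pi_succ_apply hclosed.measurableSet]
  calc _ ≤ ∫⁻ _, (ENNReal.ofReal M * ν (Metric.ball 0 1)
        * ENNReal.ofReal (ρ ^ Module.finrank ℝ E)) ^ m ∂μ := by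
        refine lintegral_mono fun x => ?_
        -- Only distances to the first point are kept, so the other points fall independently into
        -- one ball.
        calc _ ≤ Measure.pi (fun _ : Fin m => μ) (Set.univ.pi fun _ => Metric.closedBall x ρ) := by
              refine measure_mono fun y hy i _ => ?_
              simpa using hy i.succ 0
          _ = ∏ _ : Fin m, μ (Metric.closedBall x ρ) := Measure.pi_pi _ _
          _ ≤ _ := by
              rw [Finset.prod_const, Finset.card_fin]
              exact pow_le_pow_left' (hball x) m
    _ = _ := by
        rw [lintegral_const, measure_univ, mul_one, mul_pow, ← ENNReal.ofReal_pow (by positivity),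
          ← pow_mul, mul_comm m]

/-! ### Antipodal configurations and their rescaling -/

/-- At scale `r`, every point is far from exactly one other point, as for the vertices of a
cross-polytope. -/
def AntipodalConfig {ι E : Type*} [Dist E] (x : ι → E) (r : ℝ) : Prop :=
  ∀ i, ∃! j, ¬dist (x i) (x j) ≤ r

/-- Two far points have any third point as a common near neighbor. This makes the set of shapes
bounded. -/
theorem AntipodalConfig.dist_le_two {ι E : Type*} [Fintype ι] [PseudoMetricSpace E] {x : ι → E}
    (h : AntipodalConfig x 1) (hι : 3 ≤ Fintype.card ι) (i j : ι) : dist (x i) (x j) ≤ 2 := by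
  classical
  by_cases hij : dist (x i) (x j) ≤ 1
  · linarith
  have hlt : ({i, j} : Finset ι).card < Fintype.card ι :=
    (Finset.card_le_two (a := i) (b := j)).trans_lt hι
  obtain ⟨w, hw⟩ : ∃ w, w ∉ ({i, j} : Finset ι) := by
    by_contra! hall
    rw [Finset.eq_univ_iff_forall.2 hall, Finset.card_univ] at hlt
    exact lt_irrefl _ hlt
  simp only [Finset.mem_insert, Finset.mem_singleton, not_or] at hw
  have h1 : dist (x i) (x w) ≤ 1 := by
    by_contra hn
    exact hw.2 ((h i).unique hn hij)
  have h2 : dist (x j) (x w) ≤ 1 := by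
    by_contra hn
    exact hw.1 ((h j).unique hn (by rwa [dist_comm]))
  linarith [dist_triangle_right (x i) (x j) (x w)]

section Rescaling

variable {E : Type*} [NormedAddCommGroup E] [NormedSpace ℝ E]

theorem antipodalConfig_rescale {m : ℕ} {r : ℝ} (hr : 0 < r) (x : E) (y : Fin m → E) :
    AntipodalConfig (Fin.cons x (fun i => x + r • y i) : Fin (m + 1) → E) r ↔
      AntipodalConfig (Fin.cons 0 y : Fin (m + 1) → E) 1 := by
  have h : (Fin.cons x (fun i => x + r • y i) : Fin (m + 1) → E)
      = fun i => x + r • (Fin.cons 0 y : Fin (m + 1) → E) i := by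
    funext i
    refine Fin.cases ?_ (fun i => ?_) i <;> simp
  refine forall_congr' fun i => existsUnique_congr fun j => not_congr ?_
  rw [h, dist_add_left, dist_smul₀, Real.norm_of_nonneg hr.le, mul_le_iff_le_one_right hr]

theorem measurable_cons_apply [MeasurableSpace E] {m : ℕ} (x : E) (i : Fin (m + 1)) :
    Measurable fun y : Fin m → E => (Fin.cons x y : Fin (m + 1) → E) i := by
  refine Fin.cases ?_ (fun i => ?_) i
  · simp
  · simpa using measurable_pi_apply i

theorem continuous_cons_apply {m : ℕ} (x : E) (i : Fin (m + 1)) :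
    Continuous fun y : Fin m → E => (Fin.cons x y : Fin (m + 1) → E) i := by
  refine Fin.cases ?_ (fun i => ?_) i
  · simpa using continuous_const
  · simpa using continuous_apply i

end Rescaling

/-! ### Measurability through the finite proximity relation -/

section Proximity

variable {Ω ι E α : Type*} [MeasurableSpace Ω] [Finite ι] [NormedAddCommGroup E]
  [MeasurableSpace E] [OpensMeasurableSpace E] [SecondCountableTopology E] [MeasurableSpace α]

/-- The relation of being within distance `r` depends measurably on the points. -/
theorem measurable_proximity {X : ι → Ω → E} (hX : ∀ i, Measurable (X i)) (r : ℝ) :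
    Measurable fun ω (i j : ι) => dist (X i ω) (X j ω) ≤ r :=
  measurable_pi_iff.2 fun i => measurable_pi_iff.2 fun j =>
    measurableSet_setOfPred.1 (measurableSet_le ((hX i).dist (hX j)) measurable_const)

theorem measurableSet_antipodalConfig {X : ι → Ω → E} (hX : ∀ i, Measurable (X i)) (r : ℝ) :
    MeasurableSet {ω | AntipodalConfig (fun i => X i ω) r} :=
  measurable_proximity hX r
    (t := {R : ι → ι → Prop | ∀ i, ∃! j, ¬R i j}) (Set.toFinite _).measurableSet

/-- The random relation takes finitely many values, so every real function of it is measurable and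
bounded. This covers Betti numbers and component counts without inspecting them. -/
theorem integrable_of_proximity {P : Measure Ω} [IsFiniteMeasure P] {X : ι → Ω → E}
    (hX : ∀ i, Measurable (X i)) (r : ℝ) (φ : (ι → ι → Prop) → ℝ) :
    Integrable (fun ω => φ fun i j => dist (X i ω) (X j ω) ≤ r) P :=
  (Integrable.of_finite (μ := P.map fun ω (i j : ι) => dist (X i ω) (X j ω) ≤ r)
    (f := φ)).comp_measurable (measurable_proximity hX r)

end Proximity

/-! ### The volume of the antipodal shapes is positive and finite -/

/-- The vertices of a regular-enough cross-polytope projected to the plane. -/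
theorem exists_antipodal_points {d : ℕ} (hd : 2 ≤ d) (k : ℕ) :
    ∃ p : Fin (k + 1) × Bool → EuclideanSpace ℝ (Fin d), ∀ a b,
      (b = (a.1, !a.2) → 1 < dist (p a) (p b)) ∧
        (b ≠ (a.1, !a.2) → dist (p a) (p b) < 1) := by
  let i₀ : Fin d := ⟨0, by omega⟩
  let i₁ : Fin d := ⟨1, by omega⟩
  have hi : i₀ ≠ i₁ := by simp [i₀, i₁]
  -- The vectors `(1, i)` in a coordinate plane are pairwise non-parallel. After normalization,
  -- strict Cauchy–Schwarz puts non-antipodal points of the set of all `±u i` at distance below `2`,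
  -- while antipodes are at distance exactly `2`.
  let w : Fin (k + 1) → EuclideanSpace ℝ (Fin d) := fun i =>
    EuclideanSpace.single i₀ 1 + EuclideanSpace.single i₁ (i : ℝ)
  have hw0 : ∀ i, w i i₀ = 1 := fun i => by simp [w, hi]
  have hw1 : ∀ i, w i i₁ = (i : ℕ) := fun i => by simp [w, hi.symm]
  have hwne : ∀ i, w i ≠ 0 := fun i h => by
    have := hw0 i
    rw [h] at this
    simp at this
  let u : Fin (k + 1) → EuclideanSpace ℝ (Fin d) := fun i => ‖w i‖⁻¹ • w i
  have hu : ∀ i, ‖u i‖ = 1 := fun i => by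
    simp [u, norm_smul, inv_mul_cancel₀ (norm_ne_zero_iff.2 (hwne i))]
  have hinner : ∀ i j, i ≠ j → |inner ℝ (u i) (u j)| < 1 := by
    intro i j hij
    have h1 : inner ℝ (u i) (u j) = inner ℝ (w i) (w j) / (‖w i‖ * ‖w j‖) := by
      simp only [u, real_inner_smul_left, real_inner_smul_right]
      rw [div_eq_mul_inv, mul_inv]; ring
    rw [h1]
    refine lt_of_le_of_ne (abs_real_inner_div_norm_mul_norm_le_one _ _) fun h => ?_
    obtain ⟨-, t, -, ht⟩ := (abs_real_inner_div_norm_mul_norm_eq_one_iff _ _).1 h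
    have e0 := congrArg (fun v : EuclideanSpace ℝ (Fin d) => v i₀) ht
    have e1 := congrArg (fun v : EuclideanSpace ℝ (Fin d) => v i₁) ht
    simp only [PiLp.smul_apply, smul_eq_mul, hw0, hw1, mul_one] at e0 e1
    rw [← e0, one_mul] at e1
    exact hij (Fin.ext (by exact_mod_cast e1.symm))
  clear_value u
  let q : Fin (k + 1) × Bool → EuclideanSpace ℝ (Fin d) := fun a =>
    (if a.2 then (1 : ℝ) else -1) • u a.1
  have hanti : ∀ a : Fin (k + 1) × Bool, dist (q a) (q (a.1, !a.2)) = 2 := by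
    have h2 : ∀ i, ‖u i + u i‖ = 2 := fun i => by rw [← two_smul ℝ, norm_smul, hu]; norm_num
    rintro ⟨i, _ | _⟩
    · rw [dist_comm]
      simp [q, dist_eq_norm, h2]
    · simp [q, dist_eq_norm, h2]
  have hnear : ∀ a b : Fin (k + 1) × Bool, b ≠ (a.1, !a.2) → dist (q a) (q b) < 2 := by
    rintro ⟨i, x⟩ ⟨j, y⟩ hab
    by_cases hij : i = j
    · subst hij
      have : y = x := by
        by_contra hxy
        exact hab (by cases x <;> cases y <;> simp_all)
      rw [this, dist_self]
      norm_num
    · have h1 := abs_lt.1 (hinner i j hij)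
      have key : ∀ s t : ℝ, s ^ 2 = 1 → t ^ 2 = 1 → (s * t = 1 ∨ s * t = -1) →
          dist (s • u i) (t • u j) < 2 := by
        intro s t hs ht hst
        have h2 : ‖s • u i - t • u j‖ ^ 2 < 2 ^ 2 := by
          rw [norm_sub_sq_real, norm_smul, norm_smul, hu, hu, real_inner_smul_left,
            real_inner_smul_right, mul_one, mul_one, Real.norm_eq_abs, Real.norm_eq_abs, sq_abs,
            sq_abs, hs, ht, ← mul_assoc s]
          rcases hst with hst | hst <;> rw [hst] <;> linarith [h1.1, h1.2]
        rw [dist_eq_norm]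
        exact lt_of_pow_lt_pow_left₀ 2 (by norm_num) h2
      cases x <;> cases y <;> refine key _ _ ?_ ?_ ?_ <;> simp
  -- A threshold just below `2` separates the finitely many distances strictly; dividing by it moves
  -- the threshold to `1`.
  have hev : ∀ᶠ ρ : ℝ in 𝓝[<] 2, (0 < ρ ∧ ρ < 2) ∧
      ∀ a b : Fin (k + 1) × Bool, b ≠ (a.1, !a.2) → dist (q a) (q b) < ρ := by
    have h02 : ∀ᶠ ρ : ℝ in 𝓝[<] 2, 0 < ρ ∧ ρ < 2 := Ioo_mem_nhdsLT (by norm_num)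
    refine h02.and (eventually_all.2 fun a => eventually_all.2 fun b => ?_)
    by_cases hab : b ≠ (a.1, !a.2)
    · filter_upwards [Ioo_mem_nhdsLT (hnear a b hab)] with ρ hρ _ using hρ.1
    · exact Eventually.of_forall fun ρ h => absurd h hab
  obtain ⟨ρ, ⟨hρ0, hρ2⟩, hρ⟩ := hev.exists
  refine ⟨fun a => ρ⁻¹ • q a, fun a b => ?_⟩
  rw [dist_smul₀, Real.norm_of_nonneg (inv_nonneg.2 hρ0.le), inv_mul_eq_div]
  refine ⟨?_, fun h => (div_lt_one hρ0).2 (hρ a b h)⟩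
  rintro rfl
  rw [hanti, one_lt_div hρ0]
  exact hρ2

section Volume

variable {d : ℕ}

/-- The shapes `(0, y₁, …, y_m)` of antipodal configurations at unit scale. -/
def antipodalShapes (d m : ℕ) : Set (Fin m → EuclideanSpace ℝ (Fin d)) :=
  {y | AntipodalConfig (Fin.cons 0 y : Fin (m + 1) → EuclideanSpace ℝ (Fin d)) 1}

theorem measurableSet_antipodalShapes (m : ℕ) : MeasurableSet (antipodalShapes d m) :=
  measurableSet_antipodalConfig (fun i => measurable_cons_apply 0 i) 1

theorem volume_antipodalShapes_ne_top {m : ℕ} (hm : 2 ≤ m) :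
    Measure.pi (fun _ : Fin m => (volume : Measure (EuclideanSpace ℝ (Fin d))))
      (antipodalShapes d m) ≠ ∞ := by
  have hsub : antipodalShapes d m ⊆ Metric.closedBall 0 2 := by
    intro y hy
    rw [Metric.mem_closedBall, dist_pi_le_iff (by norm_num)]
    intro i
    simpa using AntipodalConfig.dist_le_two hy (by simp; omega) i.succ 0
  exact ((measure_mono hsub).trans_lt Metric.isBounded_closedBall.measure_lt_top).ne

/-- Strict inequalities with a fixed antipodal pairing cut out an open set of shapes, nonempty after
translating the planar example so that its first point is the origin. -/
theorem volume_antipodalShapes_pos (hd : 2 ≤ d) (k : ℕ) :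
    0 < Measure.pi (fun _ : Fin (2 * k + 1) => (volume : Measure (EuclideanSpace ℝ (Fin d))))
      (antipodalShapes d (2 * k + 1)) := by
  obtain ⟨p, hp⟩ := exists_antipodal_points hd k
  let e : Fin (2 * k + 1 + 1) ≃ Fin (k + 1) × Bool :=
    Fintype.equivOfCardEq (by simp; ring)
  let U : Set (Fin (2 * k + 1) → EuclideanSpace ℝ (Fin d)) := {y | ∀ i j,
    (e j = ((e i).1, !(e i).2) → 1 < dist ((Fin.cons 0 y : Fin (2 * k + 1 + 1) → _) i)
      ((Fin.cons 0 y : Fin (2 * k + 1 + 1) → EuclideanSpace ℝ (Fin d)) j)) ∧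
    (e j ≠ ((e i).1, !(e i).2) → dist ((Fin.cons 0 y : Fin (2 * k + 1 + 1) → _) i)
      ((Fin.cons 0 y : Fin (2 * k + 1 + 1) → EuclideanSpace ℝ (Fin d)) j) < 1)}
  have hUo : IsOpen U := by
    simp only [U, Set.ofPred_forall, Set.ofPred_and]
    have hc : ∀ i j : Fin (2 * k + 1 + 1), Continuous fun y => dist
        ((Fin.cons 0 y : Fin (2 * k + 1 + 1) → EuclideanSpace ℝ (Fin d)) i)
        ((Fin.cons 0 y : Fin (2 * k + 1 + 1) → EuclideanSpace ℝ (Fin d)) j) := fun i j =>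
      (continuous_cons_apply 0 i).dist (continuous_cons_apply 0 j)
    refine isOpen_iInter_of_finite fun i => isOpen_iInter_of_finite fun j => IsOpen.inter ?_ ?_
    · exact isOpen_iInter_of_finite fun _ => isOpen_lt continuous_const (hc i j)
    · exact isOpen_iInter_of_finite fun _ => isOpen_lt (hc i j) continuous_const
  have hUn : U.Nonempty := by
    refine ⟨fun i => p (e i.succ) - p (e 0), fun i j => ?_⟩
    have hcons : (Fin.cons 0 (fun i => p (e i.succ) - p (e 0)) :
        Fin (2 * k + 1 + 1) → EuclideanSpace ℝ (Fin d)) = fun i => p (e i) - p (e 0) := by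
      funext i
      refine Fin.cases ?_ (fun i => ?_) i <;> simp
    rw [hcons, dist_sub_right]
    exact hp (e i) (e j)
  refine (hUo.measure_pos _ hUn).trans_le (measure_mono fun y hy i => ?_)
  refine ⟨e.symm ((e i).1, !(e i).2), not_le.2 ((hy i _).1 (by simp)), fun j hj => ?_⟩
  by_contra hne
  exact hj ((hy i j).2 fun h => hne (by rw [← h, Equiv.symm_apply_apply])).le

end Volume

/-! ### Expected counts of subsamples -/

section Expectation

variable {Ω E : Type*} [MeasurableSpace Ω] {P : Measure Ω} [IsProbabilityMeasure P]
  [MeasurableSpace E] {X : ℕ → Ω → E} {μ : Measure E}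

theorem measure_sample_mem (hX : ∀ i, Measurable (X i)) (hind : iIndepFun X P)
    (hμ : ∀ i, P.map (X i) = μ) {N : ℕ} {σ : Fin N → ℕ} (hσ : Function.Injective σ)
    {A : Set (Fin N → E)} (hA : MeasurableSet A) :
    P {ω | (fun i => X (σ i) ω) ∈ A} = Measure.pi (fun _ : Fin N => μ) A := by
  have h := (iIndepFun_iff_map_fun_eq_pi_map fun i => (hX (σ i)).aemeasurable).1 (hind.precomp hσ)
  simp only [hμ] at h
  rw [← h, Measure.map_apply (measurable_pi_iff.2 fun i => hX (σ i)) hA]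
  rfl

/-- The expected number of `N`-element subsamples with a given property. -/
theorem integral_card_subsamples (hX : ∀ i, Measurable (X i)) (hind : iIndepFun X P)
    (hμ : ∀ i, P.map (X i) = μ) {N n : ℕ} {A : Set (Fin N → E)} (hA : MeasurableSet A)
    (B : Ω → Finset (Finset (Fin n)))
    (hB : ∀ ω S, S ∈ B ω ↔ ∃ h : S.card = N, (fun i => X (S.orderEmbOfFin h i) ω) ∈ A) :
    Integrable (fun ω => ((B ω).card : ℝ)) P ∧
      ∫ ω, ((B ω).card : ℝ) ∂P
        = n.choose N * (Measure.pi (fun _ : Fin N => μ) A).toReal := by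
  classical
  set Q := (Finset.univ : Finset (Fin n)).powersetCard N with hQ
  have hmeas : ∀ S, MeasurableSet {ω | S ∈ B ω} := by
    intro S
    simp only [hB]
    by_cases h : S.card = N
    · simp only [h, exists_true_left]
      exact (measurable_pi_iff.2 fun i => hX (S.orderEmbOfFin h i)) hA
    · simp [h]
  have hcard : ∀ ω, ((B ω).card : ℝ) = ∑ S ∈ Q, {ω | S ∈ B ω}.indicator (fun _ => (1 : ℝ)) ω := by
    intro ω
    have hsub : B ω = Q.filter fun S => S ∈ B ω := by
      ext S
      simp only [Finset.mem_filter, hQ, Finset.mem_powersetCard, Finset.subset_univ, true_and]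
      exact ⟨fun h => ⟨((hB ω S).1 h).1, h⟩, fun h => h.2⟩
    rw [hsub, Finset.card_filter]
    push_cast
    refine Finset.sum_congr rfl fun S _ => ?_
    simp only [Set.indicator, Set.mem_ofPred_eq]
  simp only [hcard]
  have hint : ∀ S ∈ Q, Integrable ({ω | S ∈ B ω}.indicator fun _ => (1 : ℝ)) P := fun S _ =>
    (integrable_const 1).indicator (hmeas S)
  refine ⟨integrable_finsetSum _ hint, ?_⟩
  rw [integral_finsetSum _ hint]
  have hterm : ∀ S ∈ Q, ∫ ω, {ω | S ∈ B ω}.indicator (fun _ => (1 : ℝ)) ω ∂P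
      = (Measure.pi (fun _ : Fin N => μ) A).toReal := by
    intro S hS
    have hSN : S.card = N := (Finset.mem_powersetCard.1 hS).2
    rw [integral_indicator_const _ (hmeas S), smul_eq_mul, mul_one, Measure.real,
      ← measure_sample_mem hX hind hμ (σ := fun i => (S.orderEmbOfFin hSN i : ℕ))
        (fun i j hij => (S.orderEmbOfFin hSN).injective (Fin.ext hij)) hA]
    congr 2
    ext ω
    simp only [Set.mem_ofPred_eq, hB, hSN, exists_true_left]
  rw [Finset.sum_congr rfl hterm, Finset.sum_const, hQ, Finset.card_powersetCard,
    Finset.card_fin, nsmul_eq_mul]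

end Expectation

/-! ### Clusters and antipodal sets as properties of subsamples -/

section Subsamples

variable {n : ℕ}

theorem mem_nearSets_iff {E : Type*} [PseudoMetricSpace E] {x : Fin n → E} {m : ℕ} {ρ : ℝ}
    {S : Finset (Fin n)} :
    S ∈ nearSets x m ρ ↔ ∃ h : S.card = m,
      (fun i => x (S.orderEmbOfFin h i)) ∈ {y : Fin m → E | ∀ i j, dist (y i) (y j) ≤ ρ} := by
  simp only [nearSets, Finset.mem_filter, Finset.mem_univ, true_and, Set.mem_ofPred_eq]
  refine ⟨fun h => ⟨h.1, fun i j => h.2 _ (S.orderEmbOfFin_mem h.1 i) _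
    (S.orderEmbOfFin_mem h.1 j)⟩, fun ⟨h, hd⟩ => ⟨h, fun i hi j hj => ?_⟩⟩
  rw [← Finset.mem_coe, ← S.range_orderEmbOfFin h] at hi hj
  obtain ⟨a, rfl⟩ := hi
  obtain ⟨b, rfl⟩ := hj
  exact hd a b

variable {E : Type*} [NormedAddCommGroup E] [NormedSpace ℝ E]

theorem mem_antipodalSets_iff {x : Fin n → E} {r : ℝ} (hr : 0 ≤ r)
    [DecidableRel (oneSkeleton (ripsComplex x r)).Adj] {k : ℕ} {S : Finset (Fin n)} :
    S ∈ antipodalSets (oneSkeleton (ripsComplex x r)) k ↔ ∃ h : S.card = 2 * k + 1 + 1,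
      (fun i => x (S.orderEmbOfFin h i)) ∈
        {y : Fin (2 * k + 1 + 1) → E | AntipodalConfig y r} := by
  simp only [antipodalSets, Finset.mem_filter, Finset.mem_univ, true_and, Set.mem_ofPred_eq]
  have hnon : ∀ u v, u ∈ nonNeighbors (oneSkeleton (ripsComplex x r)) S v ↔
      u ∈ S ∧ ¬dist (x v) (x u) ≤ r := by
    intro u v
    rw [mem_nonNeighbors, oneSkeleton_ripsComplex_adj]
    refine and_congr_right fun _ => ⟨fun h hd => h.2 ⟨h.1.symm, hd⟩, fun h => ⟨?_, fun h' => h h'.2⟩⟩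
    rintro rfl
    exact h (by rwa [dist_self])
  have hcard : S.card = 2 * (k + 1) ↔ S.card = 2 * k + 1 + 1 := by omega
  rw [hcard, and_comm]
  constructor
  · rintro ⟨h, hA⟩
    refine ⟨h, fun i => ?_⟩
    obtain ⟨w, hw⟩ := Finset.card_eq_one.1 (hA _ (S.orderEmbOfFin_mem h i))
    have hw' : ∀ u, u = w ↔ u ∈ S ∧ ¬dist (x (S.orderEmbOfFin h i)) (x u) ≤ r := fun u => by
      rw [← hnon, hw, Finset.mem_singleton]
    obtain ⟨hwS, hwd⟩ := (hw' w).1 rfl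
    rw [← Finset.mem_coe, ← S.range_orderEmbOfFin h] at hwS
    obtain ⟨j, rfl⟩ := hwS
    exact ⟨j, hwd, fun j' hj' =>
      (S.orderEmbOfFin h).injective ((hw' _).2 ⟨S.orderEmbOfFin_mem h j', hj'⟩)⟩
  · rintro ⟨h, hA⟩
    refine ⟨h, fun v hv => ?_⟩
    rw [← Finset.mem_coe, ← S.range_orderEmbOfFin h] at hv
    obtain ⟨i, rfl⟩ := hv
    obtain ⟨j, hj, huniq⟩ := hA i
    refine Finset.card_eq_one.2 ⟨S.orderEmbOfFin h j, ?_⟩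
    ext u
    rw [hnon, Finset.mem_singleton]
    constructor
    · rintro ⟨hu, hd⟩
      rw [← Finset.mem_coe, ← S.range_orderEmbOfFin h] at hu
      obtain ⟨j', rfl⟩ := hu
      rw [huniq j' hd]
    · rintro rfl
      exact ⟨S.orderEmbOfFin_mem h j, hj⟩

/-- The complex whose faces are the finite sets of pairwise related vertices. -/
def relationComplex {ι : Type*} (R : ι → ι → Prop) : AbstractSimplicialComplex ι where
  faces := {s | s.Nonempty ∧ (s : Set ι).Pairwise R}
  isRelLowerSet_faces := fun _ hs =>
    ⟨hs.1, fun _ hts ht => ⟨ht, hs.2.mono (Finset.coe_subset.mpr hts)⟩⟩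
  singleton_mem v := ⟨Finset.singleton_nonempty v, by simp⟩

/-- Exhibits the complex as a function of the proximity relation alone, the form that
`integrable_of_proximity` requires. -/
theorem ripsComplex_eq_relationComplex {ι : Type*} (x : ι → E) (r : ℝ) :
    ripsComplex x r = relationComplex fun i j => dist (x i) (x j) ≤ r := by
  have h : (fun i j => dist (x i) (x j) ≤ r) = fun i j =>
      (Metric.closedBall (x i) (r / 2) ∩ Metric.closedBall (x j) (r / 2)).Nonempty := by
    funext i j
    exact propext closedBall_inter_closedBall_half_nonempty.symm
  rw [h]
  rfl

end Subsamples

/-! ### Deterministic comparison of the counts -/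

section Comparison

variable {E : Type*} [NormedAddCommGroup E] [NormedSpace ℝ E] {n : ℕ}

open Classical in
/-- The Betti number, the number of cross-polytope components and the number of cross-polytope
subgraphs agree up to a multiple of the number of clusters of `2 k + 3` points. -/
theorem ripsComplex_counts (F : Type*) [Field F] (x : Fin n → E) {r : ℝ} (hr : 0 ≤ r) {k : ℕ}
    (hk : 1 ≤ k) :
    crossPolytopeComponents (ripsComplex x r) k ≤ betti F (ripsComplex x r) k ∧
    betti F (ripsComplex x r) k ≤ crossPolytopeComponents (ripsComplex x r) k
      + (nearSets x (2 * k + 3) ((2 * k + 3 : ℕ) * r)).card * 2 ^ (2 * k + 3) ∧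
    crossPolytopeComponents (ripsComplex x r) k
      ≤ (antipodalSets (oneSkeleton (ripsComplex x r)) k).card ∧
    (antipodalSets (oneSkeleton (ripsComplex x r)) k).card
      ≤ crossPolytopeComponents (ripsComplex x r) k
        + (nearSets x (2 * k + 3) ((2 * k + 3 : ℕ) * r)).card * 2 ^ (2 * k + 3) := by
  have hK := mem_ripsComplex_faces (x := x) (r := r)
  have hG : ∀ i j, (oneSkeleton (ripsComplex x r)).Adj i j → dist (x i) (x j) ≤ r :=
    fun i j h => (oneSkeleton_ripsComplex_adj.1 h).2
  rw [crossPolytopeComponents_eq hK]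
  exact ⟨card_antipodalComponent_le_betti F hK (by omega),
    (betti_le_card_antipodalComponent_add F hK (by omega)).trans
      (Nat.add_le_add_left (card_facesInLargeComponents_le hr hG k) _),
    card_antipodalComponent_le k, card_antipodalSets_le hr hG hk⟩

end Comparison

/-! ### Asymptotics of the scale, binomial coefficients and the final squeeze -/

section Asymptotics

/-- The exponents combine to `1 + d * (-1 / d - ε) = -ε * d`, which is negative. -/
theorem tendsto_natCast_mul_pow_zero {d : ℕ} (hd : d ≠ 0) {ε : ℝ} {r : ℕ → ℝ} (hε : 0 < ε)
    (hr : r =O[atTop] fun n : ℕ => (n : ℝ) ^ (-(1 / (d : ℝ)) - ε)) :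
    Tendsto (fun n : ℕ => (n : ℝ) * r n ^ d) atTop (𝓝 0) := by
  have h1 : (fun n : ℕ => (n : ℝ) * r n ^ d) =O[atTop]
      fun n : ℕ => (n : ℝ) * ((n : ℝ) ^ (-(1 / (d : ℝ)) - ε)) ^ d :=
    (isBigO_refl _ _).mul (hr.pow d)
  refine h1.trans_tendsto ?_
  have h2 : Tendsto (fun n : ℕ => (n : ℝ) ^ (-(ε * d))) atTop (𝓝 0) :=
    (tendsto_rpow_neg_atTop (by positivity)).comp tendsto_natCast_atTop_atTop
  refine h2.congr' ?_
  filter_upwards [eventually_gt_atTop 0] with n hn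
  have hn' : (0 : ℝ) < n := Nat.cast_pos.2 hn
  have hd' : (d : ℝ) ≠ 0 := Nat.cast_ne_zero.2 hd
  rw [← Real.rpow_mul_natCast hn'.le]
  nth_rewrite 2 [← Real.rpow_one (n : ℝ)]
  rw [← Real.rpow_add hn']
  congr 1
  field_simp
  ring

theorem tendsto_zero_of_isBigO_rpow {d : ℕ} {ε : ℝ} {r : ℕ → ℝ} (hε : 0 < ε)
    (hr : r =O[atTop] fun n : ℕ => (n : ℝ) ^ (-(1 / (d : ℝ)) - ε)) :
    Tendsto r atTop (𝓝 0) := by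
  refine hr.trans_tendsto ?_
  have h2 : Tendsto (fun n : ℕ => (n : ℝ) ^ (-(1 / (d : ℝ) + ε))) atTop (𝓝 0) :=
    (tendsto_rpow_neg_atTop (by positivity)).comp tendsto_natCast_atTop_atTop
  refine h2.congr fun n => ?_
  congr 1
  ring

theorem tendsto_choose_div_pow (N : ℕ) :
    Tendsto (fun n : ℕ => (n.choose N : ℝ) / (n : ℝ) ^ N) atTop (𝓝 (1 / N.factorial)) := by
  have h : Tendsto (fun n : ℕ => (n.choose N : ℝ) / ((n : ℝ) ^ N / N.factorial)) atTop (𝓝 1) := by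
    refine (isEquivalent_iff_tendsto_one ?_).1 (isEquivalent_choose N)
    filter_upwards [eventually_gt_atTop 0] with n hn
    positivity
  refine (h.div_const (N.factorial : ℝ)).congr fun n => ?_
  have : (N.factorial : ℝ) ≠ 0 := by positivity
  rw [div_div_eq_mul_div, mul_div_right_comm, mul_div_assoc, div_self this, mul_one]

end Asymptotics

/-- A bounded density agrees almost everywhere with a bounded measurable density. -/
theorem exists_measurable_density {E : Type*} [MeasurableSpace E] {ν : Measure E} {f : E → ℝ}
    {M : ℝ} (hf : AEMeasurable f ν) (hf0 : ∀ x, 0 ≤ f x) (hfM : ∀ x, f x ≤ M) :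
    ∃ g : E → ℝ, Measurable g ∧ f =ᵐ[ν] g ∧ (∀ x, 0 ≤ g x) ∧ ∀ x, g x ≤ M := by
  rcases isEmpty_or_nonempty E with hE | ⟨⟨x₀⟩⟩
  · exact ⟨f, measurable_of_empty f, ae_eq_rfl, hf0, hfM⟩
  · have hM : 0 ≤ M := (hf0 x₀).trans (hfM x₀)
    -- Clipping the measurable representative to `[0, M]` makes the bounds hold everywhere and
    -- changes nothing where it agrees with `f`.
    refine ⟨fun x => max 0 (min (hf.mk f x) M),
      measurable_const.max (hf.measurable_mk.min measurable_const), ?_,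
      fun x => le_max_left _ _, fun x => max_le hM (min_le_right _ _)⟩
    filter_upwards [hf.ae_eq_mk] with x hx
    rw [← hx, min_eq_left (hfM x), max_eq_right (hf0 x)]

/-- The known asymptotics of `a` pass first to `o` and then to `b`, since `e` is negligible at scale
`s`; `C ≠ 0` permits dividing the two limits. -/
theorem tendsto_div_of_sandwich {a b o e s : ℕ → ℝ} {C : ℝ} (hC : C ≠ 0)
    (hs : ∀ᶠ n in atTop, 0 < s n) (hob : ∀ n, o n ≤ b n) (hbo : ∀ n, b n ≤ o n + e n)
    (hoa : ∀ n, o n ≤ a n) (hao : ∀ n, a n ≤ o n + e n)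
    (ha : Tendsto (fun n => a n / s n) atTop (𝓝 C))
    (he : Tendsto (fun n => e n / s n) atTop (𝓝 0)) :
    Tendsto (fun n => b n / s n) atTop (𝓝 C) ∧ Tendsto (fun n => b n / o n) atTop (𝓝 1) := by
  have ho : Tendsto (fun n => o n / s n) atTop (𝓝 C) := by
    refine tendsto_of_tendsto_of_tendsto_of_le_of_le' (by simpa using ha.sub he) ha ?_ ?_
    · filter_upwards [hs] with n hn
      rw [← sub_div]
      exact div_le_div_of_nonneg_right (by linarith [hao n]) hn.le
    · filter_upwards [hs] with n hn
      exact div_le_div_of_nonneg_right (hoa n) hn.le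
  have hb : Tendsto (fun n => b n / s n) atTop (𝓝 C) := by
    refine tendsto_of_tendsto_of_tendsto_of_le_of_le' ho (by simpa using ho.add he) ?_ ?_
    · filter_upwards [hs] with n hn
      exact div_le_div_of_nonneg_right (hob n) hn.le
    · filter_upwards [hs] with n hn
      rw [← add_div]
      exact div_le_div_of_nonneg_right (hbo n) hn.le
  refine ⟨hb, ?_⟩
  have hdiv := hb.div ho hC
  rw [div_self hC] at hdiv
  refine hdiv.congr' ?_
  filter_upwards [hs] with n hn
  exact div_div_div_cancel_right₀ hn.ne' _ _

end RandomRips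

/-! ### The limit theorem -/

theorem theorem3p1 (d : ℕ) (hd : 2 ≤ d) (k : ℕ) (hk : 1 ≤ k)
    (f : EuclideanSpace ℝ (Fin d) → ℝ) (hf_meas : AEMeasurable f volume)
    (hf_nonneg : ∀ x, 0 ≤ f x) (hf_bdd : ∃ M : ℝ, ∀ x, f x ≤ M)
    (hf_int : ∫ x, f x = 1) :
    ∃ C : ℝ, 0 < C ∧
      ∀ (F : Type*) [Field F] (Ω : Type*) [MeasurableSpace Ω] (P : Measure Ω)
        [IsProbabilityMeasure P] (X : ℕ → Ω → EuclideanSpace ℝ (Fin d)),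
        (∀ i, Measurable (X i)) →
        iIndepFun X P →
        (∀ i, P.map (X i) = volume.withDensity fun x => ENNReal.ofReal (f x)) →
        ∀ (ε : ℝ) (r : ℕ → ℝ), 0 < ε → (∀ n, 0 < r n) →
        r =O[atTop] (fun n : ℕ => (n : ℝ) ^ (-(1 / (d : ℝ)) - ε)) →
        Tendsto (fun n : ℕ =>
            (∫ ω, (RandomRips.betti F
              (RandomRips.ripsComplex (fun i : Fin n => X i ω) (r n)) k : ℝ) ∂P)
              / ((n : ℝ) ^ (2 * k + 2) * r n ^ (d * (2 * k + 1))))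
          atTop (𝓝 C) ∧
        Tendsto (fun n : ℕ =>
            (∫ ω, (RandomRips.betti F
              (RandomRips.ripsComplex (fun i : Fin n => X i ω) (r n)) k : ℝ) ∂P)
              / (∫ ω, (RandomRips.crossPolytopeComponents
                (RandomRips.ripsComplex (fun i : Fin n => X i ω) (r n)) k : ℝ) ∂P))
          atTop (𝓝 1) := by
  classical
  obtain ⟨M, hM⟩ := hf_bdd
  obtain ⟨g, hg, hfg, hg0, hgM⟩ := RandomRips.exists_measurable_density hf_meas hf_nonneg hM
  have hfi : Integrable f := by
    by_contra h
    rw [integral_undef h] at hf_int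
    exact zero_ne_one hf_int
  have hgi : Integrable g := hfi.congr hfg
  have hgint : ∫ x, g x = 1 := by rw [← integral_congr_ae hfg, hf_int]
  have hdens : (volume.withDensity fun x => ENNReal.ofReal (f x))
      = volume.withDensity fun x => ENNReal.ofReal (g x) :=
    withDensity_congr_ae (hfg.mono fun x hx => by simp only [hx])
  set μ := (volume : Measure (EuclideanSpace ℝ (Fin d))).withDensity
    fun x => ENNReal.ofReal (g x) with hμdef
  have hprob : IsProbabilityMeasure μ := ⟨by
    rw [hμdef, withDensity_apply _ MeasurableSet.univ, Measure.restrict_univ,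
      ← ofReal_integral_eq_lintegral_ofReal hgi (Eventually.of_forall hg0), hgint,
      ENNReal.ofReal_one]⟩
  have hpow : 0 < ∫ x, g x ^ (2 * k + 1 + 1) := by
    have hint : Integrable fun x => g x ^ (2 * k + 1 + 1) := by
      simpa [pow_succ'] using RandomRips.integrable_mul_prod_translate hg hg0 hgM hgi
        (fun _ : Fin (2 * k + 1) => (0 : EuclideanSpace ℝ (Fin d)))
    -- A power of `g` has the support of `g`, which has positive measure because `g` integrates to
    -- one.
    have hsupp : Function.support (fun x => g x ^ (2 * k + 1 + 1)) = Function.support g := by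
      ext x; simp
    rw [integral_pos_iff_support_of_nonneg (fun x => pow_nonneg (hg0 x) _) hint, hsupp,
      ← integral_pos_iff_support_of_nonneg hg0 hgi, hgint]
    exact one_pos
  have hvol := RandomRips.volume_antipodalShapes_pos hd k
  have hvol' := RandomRips.volume_antipodalShapes_ne_top (d := d) (m := 2 * k + 1) (by omega)
  have hprobLim := RandomRips.tendsto_pi_withDensity_div hg hg0 hgM hgi
    (RandomRips.measurableSet_antipodalShapes (d := d) (2 * k + 1)) hvol'
    (A := fun r => {y | RandomRips.AntipodalConfig y r})
    (fun r => RandomRips.measurableSet_antipodalConfig (fun i => measurable_pi_apply i) r)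
    (fun r hr x y => RandomRips.antipodalConfig_rescale hr x y)
  rw [finrank_euclideanSpace_fin] at hprobLim
  set L := (∫ x, g x ^ (2 * k + 1 + 1)) * (Measure.pi
    (fun _ : Fin (2 * k + 1) => (volume : Measure (EuclideanSpace ℝ (Fin d))))
      (RandomRips.antipodalShapes d (2 * k + 1))).toReal
  have hL : 0 < L := mul_pos hpow (ENNReal.toReal_pos hvol.ne' hvol')
  have hC : 0 < 1 / ((2 * k + 1 + 1).factorial : ℝ) * L := by positivity
  -- The constant is fixed before the field, the probability space, the sample and the radii are
  -- introduced, so it depends on none of them.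
  refine ⟨_, hC, ?_⟩
  intro F _ Ω _ P _ X hX hind hlaw ε r hε hr hrO
  have hlaw' : ∀ i, P.map (X i) = μ := fun i => (hlaw i).trans hdens
  have hX' : ∀ n, ∀ i : Fin n, Measurable (X i) := fun n i => hX i
  have hnr := RandomRips.tendsto_natCast_mul_pow_zero (by omega) hε hrO
  have hr0 : Tendsto r atTop (𝓝[>] 0) := tendsto_nhdsWithin_iff.2
    ⟨RandomRips.tendsto_zero_of_isBigO_rpow hε hrO, Eventually.of_forall hr⟩
  have hA := fun n => RandomRips.integral_card_subsamples (n := n) hX hind hlaw'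
    (A := {y : Fin (2 * k + 1 + 1) → EuclideanSpace ℝ (Fin d) |
      RandomRips.AntipodalConfig y (r n)})
    (RandomRips.measurableSet_antipodalConfig (fun i => measurable_pi_apply i) (r n))
    (fun ω => RandomRips.antipodalSets (RandomRips.oneSkeleton
      (RandomRips.ripsComplex (fun i : Fin n => X i ω) (r n))) k)
    (fun ω S => RandomRips.mem_antipodalSets_iff (hr n).le)
  have hclosed : ∀ ρ : ℝ, IsClosed
      {y : Fin (2 * k + 2 + 1) → EuclideanSpace ℝ (Fin d) | ∀ i j, dist (y i) (y j) ≤ ρ} := by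
    intro ρ
    simp only [Set.ofPred_forall]
    exact isClosed_iInter fun i => isClosed_iInter fun j =>
      isClosed_le (by fun_prop) continuous_const
  have hD := fun n => RandomRips.integral_card_subsamples (n := n) hX hind hlaw'
    (hclosed ((2 * k + 3 : ℕ) * r n)).measurableSet
    (fun ω => RandomRips.nearSets (fun i : Fin n => X i ω) (2 * k + 3) ((2 * k + 3 : ℕ) * r n))
    (fun ω S => RandomRips.mem_nearSets_iff)
  have hcounts := fun n ω => RandomRips.ripsComplex_counts F (fun i : Fin n => X i ω) (hr n).le hk
  have hβ : ∀ n, Integrable (fun ω => (RandomRips.betti F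
      (RandomRips.ripsComplex (fun i : Fin n => X i ω) (r n)) k : ℝ)) P := fun n => by
    simp only [RandomRips.ripsComplex_eq_relationComplex]
    exact RandomRips.integrable_of_proximity (hX' n) (r n)
      fun R => (RandomRips.betti F (RandomRips.relationComplex R) k : ℝ)
  have ho : ∀ n, Integrable (fun ω => (RandomRips.crossPolytopeComponents
      (RandomRips.ripsComplex (fun i : Fin n => X i ω) (r n)) k : ℝ)) P := fun n => by
    simp only [RandomRips.ripsComplex_eq_relationComplex]
    exact RandomRips.integrable_of_proximity (hX' n) (r n)
      fun R => (RandomRips.crossPolytopeComponents (RandomRips.relationComplex R) k : ℝ)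
  have hs : ∀ n : ℕ, 0 < n → 0 < (n : ℝ) ^ (2 * k + 2) * r n ^ (d * (2 * k + 1)) := fun n hn =>
    mul_pos (pow_pos (Nat.cast_pos.2 hn) _) (pow_pos (hr n) _)
  -- Here `a` is the expected number of antipodal sets and `e` is `2 ^ (2 * k + 3)` times the
  -- expected number of clusters.
  refine RandomRips.tendsto_div_of_sandwich
    (a := fun n => ∫ ω, ((RandomRips.antipodalSets (RandomRips.oneSkeleton
      (RandomRips.ripsComplex (fun i : Fin n => X i ω) (r n))) k).card : ℝ) ∂P)
    (e := fun n => (∫ ω, ((RandomRips.nearSets (fun i : Fin n => X i ω) (2 * k + 3)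
      ((2 * k + 3 : ℕ) * r n)).card : ℝ) ∂P) * 2 ^ (2 * k + 3))
    hC.ne' ((eventually_gt_atTop 0).mono hs) (fun n => ?_) (fun n => ?_) (fun n => ?_)
    (fun n => ?_) ?_ ?_
  · exact integral_mono (ho n) (hβ n) fun ω => Nat.cast_le.2 (hcounts n ω).1
  · rw [← integral_mul_const, ← integral_add (ho n) ((hD n).1.mul_const _)]
    exact integral_mono (hβ n) ((ho n).add ((hD n).1.mul_const _)) fun ω => by
      have := Nat.cast_le (α := ℝ).2 (hcounts n ω).2.1
      push_cast at this ⊢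
      exact this
  · exact integral_mono (ho n) (hA n).1 fun ω => Nat.cast_le.2 (hcounts n ω).2.2.1
  · rw [← integral_mul_const, ← integral_add (ho n) ((hD n).1.mul_const _)]
    exact integral_mono (hA n).1 ((ho n).add ((hD n).1.mul_const _)) fun ω => by
      have := Nat.cast_le (α := ℝ).2 (hcounts n ω).2.2.2
      push_cast at this ⊢
      exact this
  · refine ((RandomRips.tendsto_choose_div_pow (2 * k + 1 + 1)).mul
      (hprobLim.comp hr0)).congr fun n => ?_
    rw [(hA n).2, Function.comp_apply, mul_comm d, div_mul_div_comm]
  -- A cluster has one point more than a cross-polytope: this costs a further factor `n` for the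
  -- choice and `r n ^ d` for the probability, so the ratio is at most a constant times `n * r n ^
  -- d`.
  · set K := ((ENNReal.ofReal M * (volume : Measure (EuclideanSpace ℝ (Fin d)))
      (Metric.ball 0 1)) ^ (2 * k + 2)).toReal
    have hq : ∀ n, (Measure.pi (fun _ : Fin (2 * k + 2 + 1) => μ)
        {y | ∀ i j, dist (y i) (y j) ≤ (2 * k + 3 : ℕ) * r n}).toReal
        ≤ K * ((2 * k + 3 : ℕ) * r n) ^ ((2 * k + 2) * d) := fun n => by
      have hρ : 0 ≤ (2 * k + 3 : ℕ) * r n := mul_nonneg (Nat.cast_nonneg _) (hr n).le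
      have h := RandomRips.pi_withDensity_near_le (ν := volume) hgM (2 * k + 2) hρ
      rw [finrank_euclideanSpace_fin] at h
      have h' := ENNReal.toReal_mono (ENNReal.mul_ne_top (ENNReal.pow_ne_top (ENNReal.mul_ne_top
        ENNReal.ofReal_ne_top Metric.isBounded_ball.measure_lt_top.ne)) ENNReal.ofReal_ne_top) h
      rwa [ENNReal.toReal_mul, ENNReal.toReal_ofReal (pow_nonneg hρ _)] at h'
    have hlim := hnr.const_mul (K * ((2 * k + 3 : ℕ) : ℝ) ^ ((2 * k + 2) * d) * 2 ^ (2 * k + 3))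
    rw [mul_zero] at hlim
    refine squeeze_zero' ?_ ?_ hlim
    · filter_upwards [eventually_gt_atTop 0] with n hn
      exact div_nonneg (mul_nonneg (integral_nonneg fun ω => Nat.cast_nonneg _) (by positivity))
        (hs n hn).le
    · filter_upwards [eventually_gt_atTop 0] with n hn
      rw [div_le_iff₀ (hs n hn), (hD n).2]
      have hchoose : (n.choose (2 * k + 2 + 1) : ℝ) ≤ (n : ℝ) ^ (2 * k + 2 + 1) := by
        exact_mod_cast Nat.choose_le_pow n (2 * k + 2 + 1)
      calc _ ≤ (n : ℝ) ^ (2 * k + 2 + 1) * (K * ((2 * k + 3 : ℕ) * r n) ^ ((2 * k + 2) * d))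
            * 2 ^ (2 * k + 3) := by
            gcongr
            exact hq n
        _ = _ := by
            have h1 : (2 * k + 2) * d = d + d * (2 * k + 1) := by ring
            rw [mul_pow, h1, pow_add (r n), pow_succ (n : ℝ) (2 * k + 2)]
            ring
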